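/- Let $p$ be a prime and $\mathbb K$ a field of characteristic zero. For finite groups $H,G$, a finite $(H,G)$-biset is $p$-bifree if the left and the right stabilizers of its points have order prime to $p$; let $B^\Delta(H,G)$ be the Grothendieck group of $p$-bifree $(H,G)$-bisets. Let $\mathbb K\mathcal C^\Delta$ be the category whose objects are the finite groups, with $\mathrm{Hom}(G,H)=\mathbb K\otimes_{\mathbb Z}B^\Delta(H,G)$ and composition induced by the product $X\times_H Y$ of bisets. Let $\mathbb KB:\mathbb K\mathcal C^\Delta\to\mathbb K\text{-Mod}$ be the Burnside functor, sending $G$ to $\mathbb KB(G)=\mathbb K\otimes_{\mathbb Z}B(G)$, where $B(G)$ is the Burnside ring of finite $G$-sets, and a biset $X$ to $U\mapsto X\times_G U$. For a finite group $G$, let $e^G_G$ be the primitive idempotent of $\mathbb KB(G)$ on which the linear map $\mathbb KB(G)\to\mathbb K$, $[U]\mapsto |U^G|$, takes the value $1$, and let $\mathbf e^\Delta_G$ be the subfunctor of $\mathbb KB$ generated by $e^G_G$. For a normal subgroup $N$ of $G$ put $$m_{G,N}=\frac1{|G|}\sum_{X\le G,\ XN=G}|X|\,\mu(X,G),$$ where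 $\mu$ is the Möbius function of the lattice of subgroups of $G$. A finite group $G$ is a $B^\Delta_p$-group if $m_{G,N}=0$ for every non-trivial normal subgroup $N$ of $G$ of order prime to $p$. Let $[B^\Delta_p\text{-gr}]$ be a set of representatives of the isomorphism classes of $B^\Delta_p$-groups. Write $G\gg H$ if $H\cong G/N$ for some normal subgroup $N$ of $G$ of order prime to $p$. A subset $A$ of $[B^\Delta_p\text{-gr}]$ is closed if $H\in A$, $G\in[B^\Delta_p\text{-gr}]$ and $G\gg H$ imply $G\in A$. Let $\mathcal S$ be the set of subfunctors of $\mathbb KB$ and $\mathcal T$ the set of closed subsets of $[B^\Delta_p\text{-gr}]$, both ordered by inclusion. Then $$\Theta:\mathcal S\to\mathcal T,\qquad F\mapsto\{H\in[B^\Delta_p\text{-gr}] : \mathbf e^\Delta_H\subseteq F\}$$ is a well-defined isomorphism of posets, and its inverse is $$\Psi:\mathcal T\to\mathcal S,\qquad A\mapsto\sum_{H\in A}\mathbf e^\Delta_H .$$ -/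

import Mathlib

open CategoryTheory MulOpposite TensorProduct
open Algebra (GrothendieckAddGroup)

universe u v w

noncomputable section

namespace PBifree

/-! ### Grothendieck groups and extension of scalars -/

section Grothendieck

variable {M N P A : Type*} [AddCommMonoid M] [AddCommMonoid N] [AddCommMonoid P] [AddCommGroup A]

/-- The class in the Grothendieck group of an element of a commutative monoid. -/
def cl : M →+ GrothendieckAddGroup M := GrothendieckAddGroup.of

theorem lift_cl (f : M →+ A) (m : M) : GrothendieckAddGroup.lift f (cl m) = f m :=
  DFunLike.congr_fun (GrothendieckAddGroup.lift.symm_apply_apply f) m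

theorem gr_hom_ext {f g : GrothendieckAddGroup M →+ A} (h : ∀ m, f (cl m) = g (cl m)) : f = g :=
  GrothendieckAddGroup.lift.symm.injective (AddMonoidHom.ext h)

/-- A biadditive map of commutative monoids induces one of Grothendieck groups. -/
def grLift₂ (f : M →+ N →+ P) :
    GrothendieckAddGroup M →+ GrothendieckAddGroup N →+ GrothendieckAddGroup P :=
  GrothendieckAddGroup.lift
    { toFun := fun m => GrothendieckAddGroup.lift (cl.comp (f m))
      map_zero' := gr_hom_ext fun n => by rw [lift_cl]; simp
      map_add' := fun a b => gr_hom_ext fun n => by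
        rw [AddMonoidHom.add_apply, lift_cl, lift_cl, lift_cl]; simp }

theorem grLift₂_cl (f : M →+ N →+ P) (m : M) (n : N) :
    grLift₂ f (cl m) (cl n) = cl (f m n) := by
  rw [grLift₂, lift_cl]
  exact lift_cl _ _

@[elab_as_elim]
theorem gr_ind {Q : GrothendieckAddGroup M → Prop} (x : GrothendieckAddGroup M)
    (h : ∀ a b : M, Q (cl a - cl b)) : Q x := by
  induction x using AddLocalization.ind with
  | H y =>
    have := h y.1 y.2
    rwa [show cl y.1 - cl (y.2 : M) = AddLocalization.mk y.1 y.2 from ?_] at this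
    have key (m : M) : cl m = AddLocalization.mk m 0 :=
      (AddLocalization.mk_zero_eq_addMonoidOf_mk (S := ⊤) m).symm
    rw [key, key, GrothendieckAddGroup.mk_sub_mk]
    simp

/-- The Grothendieck ring of a commutative semiring. -/
abbrev grRing (S : Type*) [CommSemiring S] : CommRing (GrothendieckAddGroup S) where
  __ : AddCommGroup (GrothendieckAddGroup S) := inferInstance
  mul x y := grLift₂ AddMonoidHom.mul x y
  one := cl 1
  left_distrib x y z := map_add (grLift₂ AddMonoidHom.mul x) y z
  right_distrib x y z := by
    change grLift₂ AddMonoidHom.mul (x + y) z = _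
    rw [map_add]; rfl
  zero_mul x := by
    change grLift₂ AddMonoidHom.mul 0 x = 0
    rw [map_zero]; rfl
  mul_zero x := map_zero (grLift₂ AddMonoidHom.mul x)
  one_mul x := by
    change grLift₂ AddMonoidHom.mul (cl 1) x = x
    induction x using gr_ind with
    | h a b => simp [map_sub, grLift₂_cl]
  mul_one x := by
    change grLift₂ AddMonoidHom.mul x (cl 1) = x
    induction x using gr_ind with
    | h a b => simp [map_sub, grLift₂_cl]
  mul_comm x y := by
    change grLift₂ AddMonoidHom.mul x y = grLift₂ AddMonoidHom.mul y x
    induction x using gr_ind with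
    | h a b =>
    induction y using gr_ind with
    | h c d =>
    simp only [map_sub, grLift₂_cl, AddMonoidHom.sub_apply, AddMonoidHom.mul_apply,
      mul_comm c, mul_comm d]
    abel
  mul_assoc x y z := by
    change grLift₂ AddMonoidHom.mul (grLift₂ AddMonoidHom.mul x y) z =
      grLift₂ AddMonoidHom.mul x (grLift₂ AddMonoidHom.mul y z)
    induction x using gr_ind with
    | h a b =>
    induction y using gr_ind with
    | h c d =>
    induction z using gr_ind with
    | h e f =>
    simp only [map_sub, grLift₂_cl, AddMonoidHom.sub_apply, AddMonoidHom.mul_apply, mul_assoc]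

variable (R : Type v) [CommRing R]

/-- A biadditive map of commutative monoids induces an `R`-bilinear map between the Grothendieck
groups with scalars extended to `R`. -/
def scalarLift₂ (f : M →+ N →+ P) :
    R ⊗[ℤ] GrothendieckAddGroup M →ₗ[R]
      R ⊗[ℤ] GrothendieckAddGroup N →ₗ[R] R ⊗[ℤ] GrothendieckAddGroup P :=
  LinearMap.liftBaseChange R
    (AddMonoidHom.toIntLinearMap
      { toFun := fun x => LinearMap.baseChange R (grLift₂ f x).toIntLinearMap
        map_zero' := by ext; simp
        map_add' := fun x y => by ext; simp [TensorProduct.tmul_add] })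

theorem scalarLift₂_tmul (f : M →+ N →+ P) (r s : R) (m : M) (n : N) :
    scalarLift₂ R f (r ⊗ₜ cl m) (s ⊗ₜ cl n) = (r * s) ⊗ₜ cl (f m n) := by
  simp [scalarLift₂, grLift₂_cl, TensorProduct.smul_tmul']

variable {R} in
@[elab_as_elim]
theorem scalar_ind {Q : R ⊗[ℤ] GrothendieckAddGroup M → Prop}
    (x : R ⊗[ℤ] GrothendieckAddGroup M) (h : ∀ (r : R) (m : M), Q (r ⊗ₜ cl m))
    (hadd : ∀ x y, Q x → Q y → Q (x + y)) : Q x := by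
  induction x using TensorProduct.induction_on with
  | zero => simpa using h 0 0
  | add x y hx hy => exact hadd x y hx hy
  | tmul r y =>
    induction y using gr_ind with
    | h a b =>
    have : r ⊗ₜ[ℤ] (cl a - cl b) = r ⊗ₜ cl a + (-r) ⊗ₜ cl b := by
      rw [TensorProduct.tmul_sub, TensorProduct.neg_tmul, sub_eq_add_neg]
    rw [this]
    exact hadd _ _ (h _ _) (h _ _)

end Grothendieck

/-! ### The product `X ×_G U` of a right `G`-set and a left `G`-set -/

section Tens

variable (G : Type*) (X U : Type*) [Group G] [MulAction Gᵐᵒᵖ X] [MulAction G U]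

/-- The relation identifying `(x g, u)` with `(x, g u)`; a right action of `G` on `X` is an action
of `Gᵐᵒᵖ`. -/
def tensSetoid : Setoid (X × U) where
  r a b := ∃ g : G, a.1 = op g • b.1 ∧ b.2 = g • a.2
  iseqv :=
    { refl := fun a => ⟨1, by simp, by simp⟩
      symm := fun {a b} ⟨g, h₁, h₂⟩ => ⟨g⁻¹, by simp [h₁], by simp [h₂]⟩
      trans := fun {a b c} ⟨g, h₁, h₂⟩ ⟨k, h₃, h₄⟩ =>
        ⟨k * g, by rw [h₁, h₃, smul_smul, op_mul], by rw [h₄, h₂, smul_smul]⟩ }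

/-- The product `X ×_G U`. -/
def Tens : Type _ := Quotient (tensSetoid G X U)

variable {X U}

/-- The class of `(x, u)` in `X ×_G U`. -/
def Tens.mk (x : X) (u : U) : Tens G X U := Quotient.mk (tensSetoid G X U) (x, u)

variable {G}

theorem Tens.mk_smul (g : G) (x : X) (u : U) :
    Tens.mk G (op g • x) u = Tens.mk G x (g • u) :=
  Quotient.sound ⟨g, rfl, rfl⟩

theorem Tens.exact {x x' : X} {u u' : U} (h : Tens.mk G x u = Tens.mk G x' u') :
    ∃ g : G, x = op g • x' ∧ u' = g • u :=
  Quotient.exact (s := tensSetoid G X U) h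

@[elab_as_elim]
theorem Tens.ind {Q : Tens G X U → Prop} (h : ∀ x u, Q (Tens.mk G x u)) (t : Tens G X U) : Q t :=
  Quotient.inductionOn t fun a => h a.1 a.2

/-- Maps out of `X ×_G U`. -/
def Tens.lift {A : Type*} (f : X → U → A) (h : ∀ (g : G) x u, f (op g • x) u = f x (g • u)) :
    Tens G X U → A :=
  Quotient.lift (fun a => f a.1 a.2) (by
    rintro ⟨a, b⟩ ⟨c, d⟩ ⟨g, h₁, h₂⟩
    dsimp only at h₁ h₂ ⊢
    rw [h₁, h₂, h])

@[simp]
theorem Tens.lift_mk {A : Type*} (f : X → U → A) (h : ∀ (g : G) x u, f (op g • x) u = f x (g • u))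
    (x : X) (u : U) : Tens.lift f h (Tens.mk G x u) = f x u := rfl

instance [Finite X] [Finite U] : Finite (Tens G X U) := Quotient.finite _

/-- A left action of `H` on `X` commuting with the right action of `G` gives a left action of `H`
on `X ×_G U`. -/
instance Tens.leftAction {H : Type*} [Group H] [MulAction H X] [SMulCommClass H Gᵐᵒᵖ X] :
    MulAction H (Tens G X U) where
  smul h := Tens.lift (fun x u => Tens.mk G (h • x) u) fun g x u => by
    rw [smul_comm, Tens.mk_smul]
  one_smul := Tens.ind fun x u => by
    change Tens.mk G ((1 : H) • x) u = _
    rw [one_smul]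
  mul_smul a b := Tens.ind fun x u => by
    change Tens.mk G ((a * b) • x) u = Tens.mk G (a • b • x) u
    rw [mul_smul]

/-- A right action of `K` on `U` commuting with the left action of `G` gives a right action of `K`
on `X ×_G U`. -/
instance Tens.rightAction {K : Type*} [Group K] [MulAction Kᵐᵒᵖ U] [SMulCommClass G Kᵐᵒᵖ U] :
    MulAction Kᵐᵒᵖ (Tens G X U) where
  smul k := Tens.lift (fun x u => Tens.mk G x (k • u)) fun g x u => by
    rw [Tens.mk_smul, smul_comm]
  one_smul := Tens.ind fun x u => by
    change Tens.mk G x ((1 : Kᵐᵒᵖ) • u) = _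
    rw [one_smul]
  mul_smul a b := Tens.ind fun x u => by
    change Tens.mk G x ((a * b) • u) = Tens.mk G x (a • b • u)
    rw [mul_smul]

theorem Tens.left_smul {H : Type*} [Group H] [MulAction H X] [SMulCommClass H Gᵐᵒᵖ X]
    (h : H) (x : X) (u : U) : h • Tens.mk G x u = Tens.mk G (h • x) u := rfl

theorem Tens.right_smul {K : Type*} [Group K] [MulAction Kᵐᵒᵖ U] [SMulCommClass G Kᵐᵒᵖ U]
    (k : K) (x : X) (u : U) : op k • Tens.mk G x u = Tens.mk G x (op k • u) := rfl

instance {H K : Type*} [Group H] [MulAction H X] [SMulCommClass H Gᵐᵒᵖ X]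
    [Group K] [MulAction Kᵐᵒᵖ U] [SMulCommClass G Kᵐᵒᵖ U] :
    SMulCommClass H Kᵐᵒᵖ (Tens G X U) where
  smul_comm _ _ := Tens.ind fun _ _ => rfl

variable (G) in
/-- Functoriality of `X ×_G U` with respect to isomorphisms. -/
def Tens.congr {X' U' : Type*} [MulAction Gᵐᵒᵖ X'] [MulAction G U'] (e : X ≃ X') (f : U ≃ U')
    (he : ∀ (g : G) x, e (op g • x) = op g • e x) (hf : ∀ (g : G) u, f (g • u) = g • f u) :
    Tens G X U ≃ Tens G X' U' where
  toFun := Tens.lift (fun x u => Tens.mk G (e x) (f u)) fun g x u => by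
    rw [he, hf, Tens.mk_smul]
  invFun := Tens.lift (fun x u => Tens.mk G (e.symm x) (f.symm u)) fun g x u => by
    have h₁ : e.symm (op g • x) = op g • e.symm x := by
      rw [Equiv.symm_apply_eq, he, Equiv.apply_symm_apply]
    have h₂ : f.symm (g • u) = g • f.symm u := by
      rw [Equiv.symm_apply_eq, hf, Equiv.apply_symm_apply]
    rw [h₁, h₂, Tens.mk_smul]
  left_inv := Tens.ind fun x u => by simp
  right_inv := Tens.ind fun x u => by simp

variable (G X U) in
/-- `(X ⊔ Y) ×_G U = (X ×_G U) ⊔ (Y ×_G U)`. -/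
def Tens.sumLeft (Y : Type*) [MulAction Gᵐᵒᵖ Y] :
    Tens G (X ⊕ Y) U ≃ Tens G X U ⊕ Tens G Y U where
  toFun := Tens.lift (fun s u => s.elim (fun x => .inl (Tens.mk G x u))
      fun y => .inr (Tens.mk G y u)) fun g s u => by
    rcases s with x | y
    · exact congrArg Sum.inl (Tens.mk_smul g x u)
    · exact congrArg Sum.inr (Tens.mk_smul g y u)
  invFun := Sum.elim
    (Tens.lift (fun x u => Tens.mk G (.inl x) u) fun g x u => Tens.mk_smul g (Sum.inl x : X ⊕ Y) u)
    (Tens.lift (fun y u => Tens.mk G (.inr y) u) fun g y u => Tens.mk_smul g (Sum.inr y : X ⊕ Y) u)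
  left_inv := Tens.ind fun s u => by rcases s with x | y <;> rfl
  right_inv := by
    rintro (t | t)
    · induction t using Tens.ind with
      | h x u => rfl
    · induction t using Tens.ind with
      | h x u => rfl

variable (G X U) in
/-- `X ×_G (U ⊔ V) = (X ×_G U) ⊔ (X ×_G V)`. -/
def Tens.sumRight (V : Type*) [MulAction G V] :
    Tens G X (U ⊕ V) ≃ Tens G X U ⊕ Tens G X V where
  toFun := Tens.lift (fun x s => s.elim (fun u => .inl (Tens.mk G x u))
      fun v => .inr (Tens.mk G x v)) fun g x s => by
    rcases s with u | v
    · exact congrArg Sum.inl (Tens.mk_smul g x u)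
    · exact congrArg Sum.inr (Tens.mk_smul g x v)
  invFun := Sum.elim
    (Tens.lift (fun x u => Tens.mk G x (.inl u)) fun g x u => Tens.mk_smul g x (Sum.inl u : U ⊕ V))
    (Tens.lift (fun x v => Tens.mk G x (.inr v)) fun g x v => Tens.mk_smul g x (Sum.inr v : U ⊕ V))
  left_inv := Tens.ind fun x s => by rcases s with u | v <;> rfl
  right_inv := by
    rintro (t | t)
    · induction t using Tens.ind with
      | h x u => rfl
    · induction t using Tens.ind with
      | h x u => rfl

variable (G U) in
/-- `G ×_G U = U`. -/
def Tens.idLeft : Tens G G U ≃ U where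
  toFun := Tens.lift (fun g u => g • u) fun g x u => by
    rw [op_smul_eq_mul, mul_smul]
  invFun u := Tens.mk G 1 u
  left_inv := Tens.ind fun g u => by
    change Tens.mk G 1 (g • u) = _
    rw [← Tens.mk_smul, op_smul_eq_mul, one_mul]
  right_inv u := one_smul G u

variable (G X) in
/-- `X ×_G G = X`. -/
def Tens.idRight : Tens G X G ≃ X where
  toFun := Tens.lift (fun x g => op g • x) fun g x u => by
    rw [smul_smul, smul_eq_mul, op_mul]
  invFun x := Tens.mk G x 1
  left_inv := Tens.ind fun x g => by
    change Tens.mk G (op g • x) 1 = _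
    rw [Tens.mk_smul, smul_eq_mul, mul_one]
  right_inv x := by
    change op (1 : G) • x = x
    rw [op_one, one_smul]

/-- `(X ×_H Y) ×_G Z = X ×_H (Y ×_G Z)`. -/
def Tens.assoc (H G : Type*) (X Y Z : Type*) [Group H] [Group G] [MulAction Hᵐᵒᵖ X]
    [MulAction H Y] [MulAction Gᵐᵒᵖ Y] [SMulCommClass H Gᵐᵒᵖ Y] [MulAction G Z] :
    Tens G (Tens H X Y) Z ≃ Tens H X (Tens G Y Z) where
  toFun := Tens.lift (fun t z => Tens.lift (fun x y => Tens.mk H x (Tens.mk G y z))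
      (fun h x y => Tens.mk_smul h x (Tens.mk G y z)) t)
    fun g t z => by
      induction t using Tens.ind with
      | h x y => exact congrArg (Tens.mk H x) (Tens.mk_smul g y z)
  invFun := Tens.lift (fun x t => Tens.lift (fun y z => Tens.mk G (Tens.mk H x y) z)
      (fun g y z => Tens.mk_smul g (Tens.mk H x y) z) t)
    fun h x t => by
      induction t using Tens.ind with
      | h y z => exact congrArg (fun s => Tens.mk G s z) (Tens.mk_smul h x y)
  left_inv t := by
    induction t using Tens.ind with
    | h s z =>
    induction s using Tens.ind with
    | h x y => rfl
  right_inv t := by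
    induction t using Tens.ind with
    | h x s =>
    induction s using Tens.ind with
    | h y z => rfl

end Tens

/-! ### Finite `G`-sets and the Burnside ring -/

section GSet

variable (G : Type u) [Group G]

/-- A finite left `G`-set. -/
structure GSet : Type (u + 1) where
  /-- the underlying set -/
  carrier : Type u
  [fin : Finite carrier]
  [act : MulAction G carrier]

attribute [instance] GSet.fin GSet.act

instance : CoeSort (GSet G) (Type u) := ⟨GSet.carrier⟩

/-- Isomorphism of `G`-sets. -/
instance gsetSetoid : Setoid (GSet G) where
  r X Y := ∃ e : X ≃ Y, ∀ (g : G) (x : X), e (g • x) = g • e x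
  iseqv :=
    { refl := fun _ => ⟨Equiv.refl _, fun _ _ => rfl⟩
      symm := fun ⟨e, h⟩ => ⟨e.symm, fun g x => by
        rw [Equiv.symm_apply_eq, h, Equiv.apply_symm_apply]⟩
      trans := fun ⟨e, h⟩ ⟨f, k⟩ => ⟨e.trans f, fun g x => by simp [h, k]⟩ }

/-- The isomorphism classes of finite `G`-sets. -/
def GSetClass : Type (u + 1) := Quotient (gsetSetoid G)

variable {G}

/-- The isomorphism class of a finite `G`-set. -/
def GSet.cls (X : GSet G) : GSetClass G := Quotient.mk _ X

theorem GSet.cls_eq {X Y : GSet G} (e : X ≃ Y) (h : ∀ (g : G) (x : X), e (g • x) = g • e x) :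
    X.cls = Y.cls := Quotient.sound ⟨e, h⟩

@[elab_as_elim]
theorem GSetClass.ind {Q : GSetClass G → Prop} (c : GSetClass G) (h : ∀ X : GSet G, Q X.cls) :
    Q c := Quotient.inductionOn c h

/-- The action of a group on the empty set. -/
instance emptyAction (A : Type*) [Group A] : MulAction A PEmpty.{u + 1} where
  smul _ x := x
  one_smul _ := rfl
  mul_smul _ _ _ := rfl

/-- The empty `G`-set. -/
def GSet.empty : GSet G where
  carrier := PEmpty

/-- The one-point `G`-set. -/
def GSet.point : GSet G where
  carrier := PUnit
  act := { smul := fun _ x => x, one_smul := fun _ => rfl, mul_smul := fun _ _ _ => rfl }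

/-- The disjoint union of two `G`-sets. -/
def GSet.sum (X Y : GSet G) : GSet G where
  carrier := X ⊕ Y

/-- The product of two `G`-sets, with the diagonal action. -/
def GSet.prod (X Y : GSet G) : GSet G where
  carrier := X × Y

instance : Zero (GSetClass G) := ⟨GSet.empty.cls⟩

instance : One (GSetClass G) := ⟨GSet.point.cls⟩

instance : Add (GSetClass G) where
  add := Quotient.map₂ GSet.sum (by
    rintro X X' ⟨e, h⟩ Y Y' ⟨f, k⟩
    exact ⟨Equiv.sumCongr e f, by
      rintro g (x | y)
      · exact congrArg Sum.inl (h g x)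
      · exact congrArg Sum.inr (k g y)⟩)

instance : Mul (GSetClass G) where
  mul := Quotient.map₂ GSet.prod (by
    rintro X X' ⟨e, h⟩ Y Y' ⟨f, k⟩
    exact ⟨Equiv.prodCongr e f, by
      rintro g ⟨x, y⟩
      exact Prod.ext (h g x) (k g y)⟩)

/-- Disjoint union and direct product make the isomorphism classes of finite `G`-sets a
commutative semiring. -/
instance : CommSemiring (GSetClass G) where
  nsmul := nsmulRec
  add_assoc a b c := by
    induction a using GSetClass.ind with | h X =>
    induction b using GSetClass.ind with | h Y =>
    induction c using GSetClass.ind with | h Z =>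
    exact GSet.cls_eq (X := (X.sum Y).sum Z) (Y := X.sum (Y.sum Z)) (Equiv.sumAssoc X Y Z)
      (by rintro g ((x | y) | z) <;> rfl)
  zero_add a := by
    induction a using GSetClass.ind with | h X =>
    exact GSet.cls_eq (X := GSet.empty.sum X) (Y := X) (Equiv.emptySum PEmpty X)
      (by rintro g (⟨⟨⟩⟩ | z); rfl)
  add_zero a := by
    induction a using GSetClass.ind with | h X =>
    exact GSet.cls_eq (X := X.sum GSet.empty) (Y := X) (Equiv.sumEmpty X PEmpty)
      (by rintro g (z | ⟨⟨⟩⟩); rfl)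
  add_comm a b := by
    induction a using GSetClass.ind with | h X =>
    induction b using GSetClass.ind with | h Y =>
    exact GSet.cls_eq (X := X.sum Y) (Y := Y.sum X) (Equiv.sumComm X Y)
      (by rintro g (x | y) <;> rfl)
  mul_assoc a b c := by
    induction a using GSetClass.ind with | h X =>
    induction b using GSetClass.ind with | h Y =>
    induction c using GSetClass.ind with | h Z =>
    exact GSet.cls_eq (X := (X.prod Y).prod Z) (Y := X.prod (Y.prod Z)) (Equiv.prodAssoc X Y Z)
      (fun g x => rfl)
  one_mul a := by
    induction a using GSetClass.ind with | h X =>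
    exact GSet.cls_eq (X := GSet.point.prod X) (Y := X) (Equiv.punitProd X) (fun g x => rfl)
  mul_one a := by
    induction a using GSetClass.ind with | h X =>
    exact GSet.cls_eq (X := X.prod GSet.point) (Y := X) (Equiv.prodPUnit X) (fun g x => rfl)
  mul_comm a b := by
    induction a using GSetClass.ind with | h X =>
    induction b using GSetClass.ind with | h Y =>
    exact GSet.cls_eq (X := X.prod Y) (Y := Y.prod X) (Equiv.prodComm X Y) (fun g x => rfl)
  zero_mul a := by
    induction a using GSetClass.ind with | h X =>
    exact GSet.cls_eq (X := GSet.empty.prod X) (Y := GSet.empty) (Equiv.pemptyProd X)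
      (by rintro g ⟨⟨⟩, x⟩)
  mul_zero a := by
    induction a using GSetClass.ind with | h X =>
    exact GSet.cls_eq (X := X.prod GSet.empty) (Y := GSet.empty) (Equiv.prodPEmpty X)
      (by rintro g ⟨x, ⟨⟩⟩)
  left_distrib a b c := by
    induction a using GSetClass.ind with | h X =>
    induction b using GSetClass.ind with | h Y =>
    induction c using GSetClass.ind with | h Z =>
    exact GSet.cls_eq (X := X.prod (Y.sum Z)) (Y := (X.prod Y).sum (X.prod Z))
      (Equiv.prodSumDistrib X Y Z) (by rintro g ⟨x, (y | z)⟩ <;> rfl)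
  right_distrib a b c := by
    induction a using GSetClass.ind with | h X =>
    induction b using GSetClass.ind with | h Y =>
    induction c using GSetClass.ind with | h Z =>
    exact GSet.cls_eq (X := (X.sum Y).prod Z) (Y := (X.prod Z).sum (Y.prod Z))
      (Equiv.sumProdDistrib X Y Z) (by rintro g ⟨(x | y), z⟩ <;> rfl)

variable (G) in
/-- The Burnside ring `B(G)`: the Grothendieck ring of finite `G`-sets. -/
abbrev Burnside : Type (u + 1) := GrothendieckAddGroup (GSetClass G)

instance : CommRing (Burnside G) := grRing (GSetClass G)

variable (R : Type v) [CommRing R]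

variable (G) in
/-- The algebra `RB(G) = R ⊗ B(G)`. -/
abbrev RBurnside : Type (max v (u + 1)) := R ⊗[ℤ] Burnside G

/-- The number of fixed points of a subgroup on a finite `G`-set, as a function on isomorphism
classes. -/
def fixCount (L : Subgroup G) : GSetClass G →+ ℕ where
  toFun := Quotient.lift (fun X : GSet G => Nat.card (MulAction.fixedPoints L X)) (by
    rintro X Y ⟨e, h⟩
    refine Nat.card_congr (e.subtypeEquiv fun x => forall_congr' fun l => ?_)
    change (l : G) • x = x ↔ (l : G) • e x = e x
    rw [← h, e.apply_eq_iff_eq])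
  map_zero' := by
    change Nat.card (MulAction.fixedPoints L (PEmpty : Type u)) = 0
    exact Nat.card_of_isEmpty
  map_add' a b := by
    induction a using GSetClass.ind with | h X =>
    induction b using GSetClass.ind with | h Y =>
    change Nat.card (MulAction.fixedPoints L (X ⊕ Y)) =
      Nat.card (MulAction.fixedPoints L X) + Nat.card (MulAction.fixedPoints L Y)
    rw [← Nat.card_sum]
    refine Nat.card_congr
      { toFun := fun s => match s with
          | ⟨.inl x, h⟩ => .inl ⟨x, fun l => Sum.inl_injective (h l)⟩
          | ⟨.inr y, h⟩ => .inr ⟨y, fun l => Sum.inr_injective (h l)⟩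
        invFun := fun s => match s with
          | .inl x => ⟨.inl x.1, fun l => congrArg Sum.inl (x.2 l)⟩
          | .inr y => ⟨.inr y.1, fun l => congrArg Sum.inr (y.2 l)⟩
        left_inv := ?_
        right_inv := ?_ }
    · rintro ⟨x | y, h⟩ <;> rfl
    · rintro (x | y) <;> rfl

/-- The mark at `L`: the `R`-linear map `RB(G) → R` that sends the class of a `G`-set `X` to
`|X^L|`. -/
def mark (L : Subgroup G) : RBurnside G R →ₗ[R] R :=
  LinearMap.liftBaseChange R (AddMonoidHom.toIntLinearMap
    (GrothendieckAddGroup.lift ((Nat.castAddMonoidHom R).comp (fixCount L))))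

/-- A primitive idempotent of a commutative ring: a non-zero idempotent that is not a sum of two
non-zero orthogonal idempotents. -/
def IsPrimitiveIdempotent {A : Type*} [CommRing A] (e : A) : Prop :=
  IsIdempotentElem e ∧ e ≠ 0 ∧ ∀ a b : A, IsIdempotentElem a → IsIdempotentElem b →
    a * b = 0 → a + b = e → a = 0 ∨ b = 0

/-- The primitive idempotent `e^G_L` of `RB(G)` indexed by the subgroup `L`: the one whose mark at
`L` is `1`. (Over a field of characteristic zero it exists and is unique.) -/
def burnsideIdempotent (L : Subgroup G) : RBurnside G R :=
  Classical.epsilon fun e => IsPrimitiveIdempotent e ∧ mark R L e = 1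

end GSet

/-! ### Bisets -/

section Biset

/-- A finite `(H, G)`-biset: a finite set with commuting left `H`-action and right `G`-action. -/
structure Biset (H G : Type u) [Group H] [Group G] : Type (u + 1) where
  /-- the underlying set -/
  carrier : Type u
  [fin : Finite carrier]
  [left : MulAction H carrier]
  [right : MulAction Gᵐᵒᵖ carrier]
  [comm : SMulCommClass H Gᵐᵒᵖ carrier]

attribute [instance] Biset.fin Biset.left Biset.right Biset.comm

variable {K H G : Type u} [Group K] [Group H] [Group G]

instance : CoeSort (Biset H G) (Type u) := ⟨Biset.carrier⟩

/-- A biset is `p`-bifree if the left and the right stabilizers of its points are `p'`-groups. -/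
def Biset.IsBifree (p : ℕ) (X : Biset H G) : Prop :=
  ∀ x : X, (Nat.card (MulAction.stabilizer H x)).Coprime p ∧
    (Nat.card (MulAction.stabilizer Gᵐᵒᵖ x)).Coprime p

/-- The empty biset. -/
def Biset.empty : Biset H G where
  carrier := PEmpty
  comm := { smul_comm := fun _ _ _ => rfl }

/-- The disjoint union of two bisets. -/
def Biset.sum (X Y : Biset H G) : Biset H G where
  carrier := X ⊕ Y

/-- The product `X ×_H Y` of bisets. -/
def Biset.comp (X : Biset K H) (Y : Biset H G) : Biset K G where
  carrier := Tens H X Y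

variable (G) in
/-- The identity biset `G`. -/
def Biset.id [Finite G] : Biset G G where
  carrier := G

/-- The product `X ×_G U` of a biset and a `G`-set. -/
def Biset.act (X : Biset H G) (U : GSet G) : GSet H where
  carrier := Tens G X U

variable (p : ℕ)

theorem Biset.isBifree_empty : (Biset.empty : Biset H G).IsBifree p := fun x => x.elim

theorem Biset.IsBifree.sum {X Y : Biset H G} (hX : X.IsBifree p) (hY : Y.IsBifree p) :
    (X.sum Y).IsBifree p := by
  rintro (x | y)
  · have h₁ : MulAction.stabilizer H (Sum.inl x : X ⊕ Y) = MulAction.stabilizer H x := by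
      ext; exact Sum.inl_injective.eq_iff
    have h₂ : MulAction.stabilizer Gᵐᵒᵖ (Sum.inl x : X ⊕ Y) = MulAction.stabilizer Gᵐᵒᵖ x := by
      ext; exact Sum.inl_injective.eq_iff
    exact ⟨h₁ ▸ (hX x).1, h₂ ▸ (hX x).2⟩
  · have h₁ : MulAction.stabilizer H (Sum.inr y : X ⊕ Y) = MulAction.stabilizer H y := by
      ext; exact Sum.inr_injective.eq_iff
    have h₂ : MulAction.stabilizer Gᵐᵒᵖ (Sum.inr y : X ⊕ Y) = MulAction.stabilizer Gᵐᵒᵖ y := by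
      ext; exact Sum.inr_injective.eq_iff
    exact ⟨h₁ ▸ (hY y).1, h₂ ▸ (hY y).2⟩

theorem Biset.isBifree_id [Finite G] : (Biset.id G).IsBifree p := by
  intro (x : G)
  have h₁ : MulAction.stabilizer G x = ⊥ := by
    ext g; simp
  have h₂ : MulAction.stabilizer Gᵐᵒᵖ x = ⊥ := by
    ext g; simp [MulAction.mem_stabilizer_iff, MulOpposite.smul_eq_mul_unop]
  constructor
  · change (Nat.card (MulAction.stabilizer G x)).Coprime p
    rw [h₁]; simp
  · change (Nat.card (MulAction.stabilizer Gᵐᵒᵖ x)).Coprime p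
    rw [h₂]; simp

theorem Biset.pow_smul_eq {A B X : Type*} [Group A] [Group B] [MulAction A X] [MulAction B X]
    [SMulCommClass A B X] {a : A} {b : B} {x : X} (h : a • x = b • x) (n : ℕ) :
    a ^ n • x = b ^ n • x := by
  induction n with
  | zero => simp
  | succ n ih => rw [pow_succ, mul_smul, h, smul_comm, ih, smul_smul, ← pow_succ']

/-- If every element of a finite group has a power, with exponent prime to `p`, lying in a
`p'`-subgroup, then the group is a `p'`-group. -/
theorem coprime_of_pow_mem [hp : Fact p.Prime] {A : Type*} [Group A] [Finite A] (S T : Subgroup A)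
    (hT : (Nat.card T).Coprime p) (h : ∀ a ∈ S, ∃ m : ℕ, m.Coprime p ∧ a ^ m ∈ T) :
    (Nat.card S).Coprime p := by
  rw [Nat.coprime_comm, hp.out.coprime_iff_not_dvd]
  intro hd
  obtain ⟨a, ha⟩ := exists_prime_orderOf_dvd_card' p hd
  obtain ⟨m, hm, hmem⟩ := h a a.2
  have h1 : ((a : A) ^ m) ^ Nat.card T = 1 := by
    have := pow_card_eq_one' (x := (⟨_, hmem⟩ : T))
    exact congrArg Subtype.val this
  rw [← pow_mul] at h1
  have h2 := orderOf_dvd_of_pow_eq_one h1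
  rw [Subgroup.orderOf_coe, ha] at h2
  have h3 : (m * Nat.card T).Coprime p := Nat.Coprime.mul_left hm hT
  exact (hp.out.coprime_iff_not_dvd.1 h3.symm) h2

theorem Biset.IsBifree.comp [Fact p.Prime] [Finite K] [Finite H] [Finite G] {X : Biset K H}
    {Y : Biset H G} (hX : X.IsBifree p) (hY : Y.IsBifree p) : (X.comp Y).IsBifree p := by
  intro (t : Tens H X Y)
  induction t using Tens.ind with | h x y =>
  constructor
  · refine coprime_of_pow_mem p _ (MulAction.stabilizer K x) (hX x).1 fun k hk => ?_
    obtain ⟨h, h₁, h₂⟩ := Tens.exact (G := H) (x := k • x) (x' := x) (u := y) (u' := y) hk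
    refine ⟨_, (hY y).1, ?_⟩
    rw [MulAction.mem_stabilizer_iff, Biset.pow_smul_eq h₁, ← op_pow]
    have : h ^ Nat.card (MulAction.stabilizer H y) = 1 :=
      congrArg Subtype.val (pow_card_eq_one' (x := (⟨h, h₂.symm⟩ : MulAction.stabilizer H y)))
    rw [this, op_one, one_smul]
  · have : Finite Gᵐᵒᵖ := Finite.of_equiv G opEquiv
    refine coprime_of_pow_mem p _ (MulAction.stabilizer Gᵐᵒᵖ y) (hY y).2 fun k hk => ?_
    obtain ⟨h, h₁, h₂⟩ := Tens.exact (G := H) (x := x) (x' := x) (u := k • y) (u' := y) hk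
    refine ⟨_, (hX x).2, ?_⟩
    have h₃ : h⁻¹ • y = k • y := by rw [inv_smul_eq_iff]; exact h₂
    rw [MulAction.mem_stabilizer_iff, ← Biset.pow_smul_eq h₃]
    have : (op h) ^ Nat.card (MulAction.stabilizer Hᵐᵒᵖ x) = 1 :=
      congrArg Subtype.val
        (pow_card_eq_one' (x := (⟨op h, h₁.symm⟩ : MulAction.stabilizer Hᵐᵒᵖ x)))
    rw [← op_pow, op_eq_one_iff] at this
    rw [inv_pow, this, inv_one, one_smul]

variable (H G)

/-- Isomorphism of `p`-bifree `(H, G)`-bisets. -/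
instance bisetSetoid : Setoid {X : Biset H G // X.IsBifree p} where
  r X Y := ∃ e : X.1 ≃ Y.1, (∀ (h : H) (x : X.1), e (h • x) = h • e x) ∧
    ∀ (g : G) (x : X.1), e (op g • x) = op g • e x
  iseqv :=
    { refl := fun _ => ⟨Equiv.refl _, fun _ _ => rfl, fun _ _ => rfl⟩
      symm := fun ⟨e, h, k⟩ => ⟨e.symm,
        fun g x => by rw [Equiv.symm_apply_eq, h, Equiv.apply_symm_apply],
        fun g x => by rw [Equiv.symm_apply_eq, k, Equiv.apply_symm_apply]⟩
      trans := fun ⟨e, h, k⟩ ⟨e', h', k'⟩ =>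
        ⟨e.trans e', fun g x => by simp [h, h'], fun g x => by simp [k, k']⟩ }

/-- The isomorphism classes of `p`-bifree `(H, G)`-bisets. -/
def BifreeClass : Type (u + 1) := Quotient (bisetSetoid H G p)

variable {H G} {p}

/-- The isomorphism class of a `p`-bifree biset. -/
def Biset.cls (X : Biset H G) (hX : X.IsBifree p) : BifreeClass H G p := Quotient.mk _ ⟨X, hX⟩

theorem Biset.cls_eq {X Y : Biset H G} (hX : X.IsBifree p) (hY : Y.IsBifree p) (e : X ≃ Y)
    (h : ∀ (h : H) (x : X), e (h • x) = h • e x) (k : ∀ (g : G) (x : X), e (op g • x) = op g • e x) :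
    X.cls hX = Y.cls hY := Quotient.sound ⟨e, h, k⟩

@[elab_as_elim]
theorem BifreeClass.ind {Q : BifreeClass H G p → Prop} (c : BifreeClass H G p)
    (h : ∀ (X : Biset H G) (hX : X.IsBifree p), Q (X.cls hX)) : Q c :=
  Quotient.inductionOn c fun X => h X.1 X.2

instance : Zero (BifreeClass H G p) := ⟨Biset.empty.cls (Biset.isBifree_empty p)⟩

instance : Add (BifreeClass H G p) where
  add := Quotient.map₂ (fun X Y => ⟨X.1.sum Y.1, X.2.sum p Y.2⟩) (by
    rintro X X' ⟨e, h, k⟩ Y Y' ⟨e', h', k'⟩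
    refine ⟨Equiv.sumCongr e e', ?_, ?_⟩
    · rintro g (x | y)
      · exact congrArg Sum.inl (h g x)
      · exact congrArg Sum.inr (h' g y)
    · rintro g (x | y)
      · exact congrArg Sum.inl (k g x)
      · exact congrArg Sum.inr (k' g y))

/-- Disjoint union makes the isomorphism classes of `p`-bifree bisets a commutative monoid. -/
instance : AddCommMonoid (BifreeClass H G p) where
  nsmul := nsmulRec
  add_assoc a b c := by
    induction a using BifreeClass.ind with | h X hX =>
    induction b using BifreeClass.ind with | h Y hY =>
    induction c using BifreeClass.ind with | h Z hZ =>
    exact Biset.cls_eq (X := (X.sum Y).sum Z) (Y := X.sum (Y.sum Z)) _ _ (Equiv.sumAssoc X Y Z)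
      (by rintro g ((x | y) | z) <;> rfl) (by rintro g ((x | y) | z) <;> rfl)
  zero_add a := by
    induction a using BifreeClass.ind with | h X hX =>
    exact Biset.cls_eq (X := Biset.empty.sum X) (Y := X) _ _ (Equiv.emptySum PEmpty X)
      (by rintro g (⟨⟨⟩⟩ | z); rfl) (by rintro g (⟨⟨⟩⟩ | z); rfl)
  add_zero a := by
    induction a using BifreeClass.ind with | h X hX =>
    exact Biset.cls_eq (X := X.sum Biset.empty) (Y := X) _ _ (Equiv.sumEmpty X PEmpty)
      (by rintro g (z | ⟨⟨⟩⟩); rfl) (by rintro g (z | ⟨⟨⟩⟩); rfl)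
  add_comm a b := by
    induction a using BifreeClass.ind with | h X hX =>
    induction b using BifreeClass.ind with | h Y hY =>
    exact Biset.cls_eq (X := X.sum Y) (Y := Y.sum X) _ _ (Equiv.sumComm X Y)
      (by rintro g (x | y) <;> rfl) (by rintro g (x | y) <;> rfl)

variable (H G p) in
/-- The group `B^Δ(H, G)`: the Grothendieck group of `p`-bifree `(H, G)`-bisets. -/
abbrev BDelta : Type (u + 1) := GrothendieckAddGroup (BifreeClass H G p)

/-- Composition of isomorphism classes of `p`-bifree bisets. -/
def BifreeClass.comp [Fact p.Prime] [Finite K] [Finite H] [Finite G] :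
    BifreeClass K H p → BifreeClass H G p → BifreeClass K G p :=
  Quotient.map₂ (fun X Y => ⟨X.1.comp Y.1, X.2.comp p Y.2⟩) (by
    rintro X X' ⟨e, h, k⟩ Y Y' ⟨e', h', k'⟩
    refine ⟨Tens.congr H e e' k h', fun g => Tens.ind fun x y => ?_,
      fun g => Tens.ind fun x y => ?_⟩
    · exact congrArg (fun z => Tens.mk H z (e' y)) (h g x)
    · exact congrArg (fun z => Tens.mk H (e x) z) (k' g y))

/-- Composition of isomorphism classes of `p`-bifree bisets, as a biadditive map. -/
def compHom [Fact p.Prime] [Finite K] [Finite H] [Finite G] :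
    BifreeClass K H p →+ BifreeClass H G p →+ BifreeClass K G p where
  toFun a :=
    { toFun := fun b => a.comp b
      map_zero' := by
        induction a using BifreeClass.ind with | h X hX =>
        exact Biset.cls_eq (X := X.comp Biset.empty) (Y := Biset.empty) _ _
          ⟨Tens.lift (fun _ y => y) fun _ _ y => y.elim, fun y => y.elim,
            Tens.ind fun _ y => y.elim, fun y => y.elim⟩
          (fun _ => Tens.ind fun _ y => y.elim) (fun _ => Tens.ind fun _ y => y.elim)
      map_add' := fun b c => by
        induction a using BifreeClass.ind with | h X hX =>
        induction b using BifreeClass.ind with | h Y hY =>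
        induction c using BifreeClass.ind with | h Z hZ =>
        exact Biset.cls_eq (X := X.comp (Y.sum Z)) (Y := (X.comp Y).sum (X.comp Z)) _ _
          (Tens.sumRight H X Y Z)
          (fun _ => Tens.ind fun _ s => by rcases s with y | z <;> rfl)
          (fun _ => Tens.ind fun _ s => by rcases s with y | z <;> rfl) }
  map_zero' := by
    ext b
    induction b using BifreeClass.ind with | h Y hY =>
    exact Biset.cls_eq (X := Biset.empty.comp Y) (Y := Biset.empty) _ _
      ⟨Tens.lift (fun x _ => x) fun _ x _ => x.elim, fun x => x.elim,
        Tens.ind fun x _ => x.elim, fun x => x.elim⟩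
      (fun _ => Tens.ind fun x _ => x.elim) (fun _ => Tens.ind fun x _ => x.elim)
  map_add' a b := by
    ext c
    induction a using BifreeClass.ind with | h X hX =>
    induction b using BifreeClass.ind with | h Y hY =>
    induction c using BifreeClass.ind with | h Z hZ =>
    exact Biset.cls_eq (X := (X.sum Y).comp Z) (Y := (X.comp Z).sum (Y.comp Z)) _ _
      (Tens.sumLeft H X Z Y)
      (fun _ => Tens.ind fun s _ => by rcases s with x | y <;> rfl)
      (fun _ => Tens.ind fun s _ => by rcases s with x | y <;> rfl)

/-- The action of isomorphism classes of `p`-bifree `(H, G)`-bisets on isomorphism classes of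
finite `G`-sets. -/
def BifreeClass.act : BifreeClass H G p → GSetClass G → GSetClass H :=
  Quotient.map₂ (fun X U => X.1.act U) (by
    rintro X X' ⟨e, h, k⟩ U U' ⟨f, h'⟩
    exact ⟨Tens.congr G e f k h', fun g => Tens.ind fun x u =>
      congrArg (fun z => Tens.mk G z (f u)) (h g x)⟩)

/-- The action of `p`-bifree bisets on finite `G`-sets, as a biadditive map. -/
def actHom : BifreeClass H G p →+ GSetClass G →+ GSetClass H where
  toFun a :=
    { toFun := fun b => a.act b
      map_zero' := by
        induction a using BifreeClass.ind with | h X hX =>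
        exact GSet.cls_eq (X := X.act GSet.empty) (Y := GSet.empty)
          ⟨Tens.lift (fun _ y => y) fun _ _ y => y.elim, fun y => y.elim,
            Tens.ind fun _ y => y.elim, fun y => y.elim⟩
          (fun _ => Tens.ind fun _ y => y.elim)
      map_add' := fun b c => by
        induction a using BifreeClass.ind with | h X hX =>
        induction b using GSetClass.ind with | h U =>
        induction c using GSetClass.ind with | h V =>
        exact GSet.cls_eq (X := X.act (U.sum V)) (Y := (X.act U).sum (X.act V))
          (Tens.sumRight G X U V)
          (fun _ => Tens.ind fun _ s => by rcases s with y | z <;> rfl) }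
  map_zero' := by
    ext b
    induction b using GSetClass.ind with | h U =>
    exact GSet.cls_eq (X := Biset.empty.act U) (Y := GSet.empty)
      ⟨Tens.lift (fun x _ => x) fun _ x _ => x.elim, fun x => x.elim,
        Tens.ind fun x _ => x.elim, fun x => x.elim⟩
      (fun _ => Tens.ind fun x _ => x.elim)
  map_add' a b := by
    ext c
    induction a using BifreeClass.ind with | h X hX =>
    induction b using BifreeClass.ind with | h Y hY =>
    induction c using GSetClass.ind with | h U =>
    exact GSet.cls_eq (X := (X.sum Y).act U) (Y := (X.act U).sum (Y.act U))
      (Tens.sumLeft G X U Y)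
      (fun _ => Tens.ind fun s _ => by rcases s with x | y <;> rfl)

variable (G p) in
/-- The class of the identity biset. -/
def idClass [Finite G] : BifreeClass G G p := (Biset.id G).cls (Biset.isBifree_id p)

section laws

variable [Finite G] [Finite H] [Finite K]

theorem id_compHom [Fact p.Prime] (a : BifreeClass H G p) : compHom (idClass H p) a = a := by
  induction a using BifreeClass.ind with | h X hX =>
  exact Biset.cls_eq (X := (Biset.id H).comp X) (Y := X) _ _ (Tens.idLeft H X)
    (fun h => Tens.ind fun k x => mul_smul h k x)
    (fun g => Tens.ind fun (k : H) x => smul_comm k (op g) x)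

theorem compHom_id [Fact p.Prime] (a : BifreeClass H G p) : compHom a (idClass G p) = a := by
  induction a using BifreeClass.ind with | h X hX =>
  exact Biset.cls_eq (X := X.comp (Biset.id G)) (Y := X) _ _ (Tens.idRight G X)
    (fun h => Tens.ind fun x (g : G) => (smul_comm h (op g) x).symm)
    (fun g => Tens.ind fun x k => mul_smul (op g) (op k) x)

theorem compHom_assoc [Fact p.Prime] {J : Type u} [Group J] [Finite J] (a : BifreeClass J K p)
    (b : BifreeClass K H p) (c : BifreeClass H G p) :
    compHom (compHom a b) c = compHom a (compHom b c) := by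
  induction a using BifreeClass.ind with | h X hX =>
  induction b using BifreeClass.ind with | h Y hY =>
  induction c using BifreeClass.ind with | h Z hZ =>
  refine Biset.cls_eq (X := (X.comp Y).comp Z) (Y := X.comp (Y.comp Z)) _ _ (Tens.assoc K H X Y Z)
    (fun h => Tens.ind fun t z => ?_) (fun g => Tens.ind fun t z => ?_)
  · induction t using Tens.ind with | h x y => rfl
  · induction t using Tens.ind with | h x y => rfl

theorem id_actHom (c : GSetClass G) : actHom (idClass G p) c = c := by
  induction c using GSetClass.ind with | h U =>
  exact GSet.cls_eq (X := (Biset.id G).act U) (Y := U) (Tens.idLeft G U)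
    (fun h => Tens.ind fun k x => mul_smul h k x)

theorem actHom_compHom [Fact p.Prime] (a : BifreeClass K H p) (b : BifreeClass H G p) (c : GSetClass G) :
    actHom (compHom a b) c = actHom a (actHom b c) := by
  induction a using BifreeClass.ind with | h X hX =>
  induction b using BifreeClass.ind with | h Y hY =>
  induction c using GSetClass.ind with | h U =>
  refine GSet.cls_eq (X := (X.comp Y).act U) (Y := X.act (Y.act U)) (Tens.assoc H G X Y U)
    (fun h => Tens.ind fun t z => ?_)
  induction t using Tens.ind with | h x y => rfl

end laws

end Biset

/-! ### The `p`-bifree biset category and the Burnside functor -/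

section Category

/-- The category `RC^Δ`: its objects are the finite groups. -/
structure BifreeCat (p : ℕ) (R : Type v) : Type (u + 1) where
  /-- the underlying finite group -/
  grp : FiniteGrp.{u}

variable (p : ℕ) [Fact p.Prime] (R : Type v) [CommRing R]

/-- Morphisms from `G` to `H` in `RC^Δ` are the elements of `R ⊗ B^Δ(H, G)`, and composition is
induced by the product of bisets. -/
instance : Category.{max v (u + 1)} (BifreeCat.{u, v} p R) where
  Hom G H := R ⊗[ℤ] BDelta H.grp G.grp p
  id G := 1 ⊗ₜ cl (idClass G.grp p)
  comp f g := scalarLift₂ R compHom g f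
  id_comp f := by
    induction f using scalar_ind with
    | h r a => rw [scalarLift₂_tmul, mul_one, compHom_id]
    | hadd x y hx hy => rw [map_add, LinearMap.add_apply, hx, hy]
  comp_id f := by
    induction f using scalar_ind with
    | h r a => rw [scalarLift₂_tmul, one_mul, id_compHom]
    | hadd x y hx hy => rw [map_add, hx, hy]
  assoc f g h := by
    induction f using scalar_ind with
    | hadd x y hx hy => simp only [map_add, hx, hy]
    | h r a =>
    induction g using scalar_ind with
    | hadd x y hx hy => simp only [map_add, LinearMap.add_apply, hx, hy]
    | h s b =>
    induction h using scalar_ind with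
    | hadd x y hx hy => simp only [map_add, LinearMap.add_apply, hx, hy]
    | h t c => simp only [scalarLift₂_tmul, compHom_assoc, mul_assoc]

instance homGroup (G H : BifreeCat.{u, v} p R) : AddCommGroup (G ⟶ H) :=
  inferInstanceAs (AddCommGroup (R ⊗[ℤ] BDelta H.grp G.grp p))

instance homModule (G H : BifreeCat.{u, v} p R) : Module R (G ⟶ H) :=
  inferInstanceAs (Module R (R ⊗[ℤ] BDelta H.grp G.grp p))

instance : Preadditive (BifreeCat.{u, v} p R) where
  add_comp _ _ _ f f' g := map_add (scalarLift₂ R compHom g) f f'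
  comp_add _ _ _ f g g' := by
    change scalarLift₂ R compHom (g + g') f = _
    rw [map_add]; rfl

instance : Linear R (BifreeCat.{u, v} p R) where
  smul_comp _ _ _ r f g := map_smul (scalarLift₂ R compHom g) r f
  comp_smul _ _ _ f r g := by
    change scalarLift₂ R compHom (r • g) f = _
    rw [map_smul]; rfl

/-- The Burnside functor `RB` on `RC^Δ`: it sends `G` to `RB(G)`, and `X` to `U ↦ X ×_G U`. -/
def burnsideFunctor : BifreeCat.{u, v} p R ⥤ ModuleCat.{max v (u + 1)} R where
  obj G := ModuleCat.of R (RBurnside G.grp R)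
  map {G H} f := ModuleCat.ofHom (scalarLift₂ R (actHom (H := H.grp) (G := G.grp) (p := p)) f)
  map_id G := by
    refine ModuleCat.hom_ext (LinearMap.ext fun x => ?_)
    change scalarLift₂ R actHom (1 ⊗ₜ cl (idClass G.grp p)) x = x
    induction x using scalar_ind with
    | h r a => rw [scalarLift₂_tmul, one_mul, id_actHom]
    | hadd x y hx hy => rw [map_add, hx, hy]
  map_comp f g := by
    refine ModuleCat.hom_ext (LinearMap.ext fun x => ?_)
    change scalarLift₂ R actHom (scalarLift₂ R compHom g f) x =
      scalarLift₂ R actHom g (scalarLift₂ R actHom f x)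
    induction x using scalar_ind with
    | hadd x y hx hy => simp only [map_add, hx, hy]
    | h r a =>
    induction f using scalar_ind with
    | hadd x y hx hy => simp only [map_add, LinearMap.add_apply, hx, hy]
    | h s b =>
    induction g using scalar_ind with
    | hadd x y hx hy => simp only [map_add, LinearMap.add_apply, hx, hy]
    | h t c => simp only [scalarLift₂_tmul, actHom_compHom, mul_assoc]

instance : (burnsideFunctor.{u, v} p R).Additive where
  map_add {_ _ f g} := ModuleCat.hom_ext (map_add (scalarLift₂ R actHom) f g)

instance : (burnsideFunctor.{u, v} p R).Linear R where
  map_smul f r := ModuleCat.hom_ext (map_smul (scalarLift₂ R actHom) r f)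

end Category

/-! ### Subfunctors -/

section Subfunctor

variable {C : Type*} [Category C] {R : Type v} [CommRing R]

/-- A subfunctor of a functor with values in `R`-modules: a family of submodules stable under all
morphisms. -/
@[ext]
structure SubmoduleFunctor (F : C ⥤ ModuleCat.{w} R) where
  /-- the evaluation at `X` -/
  obj : ∀ X : C, Submodule R (F.obj X)
  map_mem : ∀ {X Y : C} (f : X ⟶ Y) (x : F.obj X), x ∈ obj X → (F.map f).hom x ∈ obj Y

variable {F : C ⥤ ModuleCat.{w} R}

/-- Subfunctors are ordered by inclusion. -/
instance : PartialOrder (SubmoduleFunctor F) :=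
  PartialOrder.lift SubmoduleFunctor.obj fun _ _ => SubmoduleFunctor.ext

/-- The sum of a family of subfunctors. -/
def SubmoduleFunctor.sum {ι : Type*} (T : ι → SubmoduleFunctor F) : SubmoduleFunctor F where
  obj X := ⨆ i, (T i).obj X
  map_mem {X Y} f x hx := by
    have : (⨆ i, (T i).obj X) ≤ (⨆ i, (T i).obj Y).comap (F.map f).hom :=
      iSup_le fun i x hx => Submodule.mem_iSup_of_mem i ((T i).map_mem f x hx)
    exact this hx

/-- The subfunctor generated by an element `x` of `F(X)`. -/
def SubmoduleFunctor.generated {X : C} (x : F.obj X) : SubmoduleFunctor F where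
  obj Y := Submodule.span R (Set.range fun f : X ⟶ Y => (F.map f).hom x)
  map_mem {Y Z} g y hy := by
    have : Submodule.span R (Set.range fun f : X ⟶ Y => (F.map f).hom x) ≤
        (Submodule.span R (Set.range fun f : X ⟶ Z => (F.map f).hom x)).comap (F.map g).hom := by
      rw [Submodule.span_le]
      rintro _ ⟨f, rfl⟩
      exact Submodule.subset_span ⟨f ≫ g, by simp⟩
    exact this hy

end Subfunctor

/-! ### `B^Δ_p`-groups and the subfunctors `e^Δ_G` -/

section BGroup

open Classical in
/-- The deflation number `m_{G,N} = |G|⁻¹ ∑_{XN = G} |X| μ(X, G)`, where `X` runs over subgroups of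
`G` and `μ` is the Möbius function of the lattice of subgroups; for normal `N`, the subgroup `XN` is
`X ⊔ N`. -/
def deflationNumber (G : Type u) [Group G] [Finite G] (N : Subgroup G) : ℚ :=
  letI : Fintype (Subgroup G) := Fintype.ofFinite _
  letI : LocallyFiniteOrder (Subgroup G) := Fintype.toLocallyFiniteOrder
  (Nat.card G : ℚ)⁻¹ * ∑ X : Subgroup G with X ⊔ N = ⊤,
    (Nat.card X : ℚ) * IncidenceAlgebra.mu ℚ X ⊤

/-- `G` is a `B^Δ_p`-group if `m_{G,N} = 0` for every non-trivial normal `p'`-subgroup `N`. -/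
def IsBDeltaGroup (p : ℕ) (G : FiniteGrp.{u}) : Prop :=
  ∀ N : Subgroup G, N.Normal → N ≠ ⊥ → (Nat.card N).Coprime p → deflationNumber G N = 0

/-- The relation `G ≫ H`: `H` is isomorphic to a quotient of `G` by a normal `p'`-subgroup. -/
def Dominates (p : ℕ) (G H : FiniteGrp.{u}) : Prop :=
  ∃ (N : Subgroup G) (_ : N.Normal), (Nat.card N).Coprime p ∧ Nonempty (G ⧸ N ≃* H)

/-- `S` is a set of representatives of the isomorphism classes of `B^Δ_p`-groups. -/
def IsBDeltaRepresentatives (p : ℕ) (S : Set FiniteGrp.{u}) : Prop :=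
  (∀ G ∈ S, IsBDeltaGroup p G) ∧
    ∀ G : FiniteGrp.{u}, IsBDeltaGroup p G → ∃! H : FiniteGrp.{u}, H ∈ S ∧ Nonempty (G ≃* H)

theorem exists_bDeltaRepresentatives (p : ℕ) :
    ∃ S : Set FiniteGrp.{u}, IsBDeltaRepresentatives p S := by
  let s : Setoid {G : FiniteGrp.{u} // IsBDeltaGroup p G} :=
    { r := fun G H => Nonempty (G.1 ≃* H.1)
      iseqv := ⟨fun _ => ⟨MulEquiv.refl _⟩, fun ⟨e⟩ => ⟨e.symm⟩, fun ⟨e⟩ ⟨f⟩ => ⟨e.trans f⟩⟩ }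
  refine ⟨Set.range fun c : Quotient s => c.out.1, ?_, fun G hG => ?_⟩
  · rintro _ ⟨c, rfl⟩
    exact c.out.2
  · refine ⟨(Quotient.mk s ⟨G, hG⟩).out.1, ⟨⟨_, rfl⟩, ?_⟩, ?_⟩
    · exact s.symm (Quotient.mk_out (s := s) ⟨G, hG⟩)
    · rintro _ ⟨⟨c, rfl⟩, h⟩
      have : Quotient.mk s ⟨G, hG⟩ = c := by
        rw [← Quotient.out_eq c]
        exact Quotient.sound h
      rw [this]

/-- The closed subsets of `S`, ordered by inclusion. -/
abbrev ClosedSubset (p : ℕ) (S : Set FiniteGrp.{u}) : Type (u + 1) :=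
  {A : Set FiniteGrp.{u} // A ⊆ S ∧ ∀ H ∈ A, ∀ G ∈ S, Dominates p G H → G ∈ A}

/-- The subfunctor `e^Δ_G` of `KB` generated by the idempotent `e^G_G` of `KB(G)`. -/
def eDelta (p : ℕ) [Fact p.Prime] (K : Type v) [Field K] (G : FiniteGrp.{u}) :
    SubmoduleFunctor (burnsideFunctor.{u, v} p K) :=
  SubmoduleFunctor.generated (X := (⟨G⟩ : BifreeCat.{u, v} p K))
    (burnsideIdempotent K (⊤ : Subgroup G))

end BGroup

end PBifree

end

/-! The marks $U\mapsto|U^L|$ separate the points of $\mathbb KB(G)$, and $e^G_G$ is given by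
Gluck's formula $|G|^{-1}\sum_X|X|\mu(X,G)[G/X]$ (`topIdem`); moreover $e^G_G\,x=|x^G|\,e^G_G$.
Since $[G/X]\,x$ is the induction of the restriction of $x$ to $X$, every subfunctor is stable under
multiplication by $e^G_G$. Hence $e^G_G\in F(G)$ as soon as $F(G)$ contains one element with
non-zero mark at $G$ (`topIdem_mem_of_mark_ne_zero`). As $[G/G]=1$ has coefficient $1$ in $e^G_G$,
any $x$ is $e^G_G\,x$ minus elements induced from proper subgroups, so induction on $|G|$ shows that
$F$ is determined by the $e^G_G$ it contains (`le_of_eDelta_le`).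

It remains to decide which $\mathbf e^\Delta_G$ lie in a sum of $\mathbf e^\Delta_H$, and this
depends only on marks at $G$ of images of $e^H_H$. Inflation along a surjection with $p'$-kernel
gives mark $1$, so $G\gg H$ implies $\mathbf e^\Delta_G\subseteq\mathbf e^\Delta_H$. Deflation of
$e^G_G$ to $G/N$ has mark $m_{G,N}$, so if this is non-zero then $\mathbf e^\Delta_G=\mathbf
e^\Delta_{G/N}$; iterating, every $\mathbf e^\Delta_G$ comes from a $B^\Delta_p$-group.

Conversely, let $H$ be a $B^\Delta_p$-group and $X$ a transitive $(G,H)$-biset sending $e^H_H$ to an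
element of non-zero mark at $G$. For $x$ suitably chosen in $X$, the orbits $Gx$ and $xH$ must
coincide, and the mark is $m_{H,M}$ with $M$ the right stabilizer of $x$, a $p'$-group. So $M=1$,
and $X$ is given by a surjection $G\to H$ with $p'$-kernel: $G\gg H$ (`dominates_of_mark_ne_zero`).
By linearity of the mark, $\mathbf e^\Delta_G\subseteq\sum_{H\in A}\mathbf e^\Delta_H$ forces $G\gg
H$ for some $H\in A$, and closedness gives $G\in A$. -/

noncomputable section

namespace PBifree

/-! ### Linear maps out of `RB(G)` -/

section Linear

variable {M A : Type*} [AddCommMonoid M] [AddCommGroup A] (R : Type v) [CommRing R] [Module R A]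

variable {R} in
theorem scalar_hom_ext {f g : R ⊗[ℤ] GrothendieckAddGroup M →ₗ[R] A}
    (h : ∀ m, f (1 ⊗ₜ cl m) = g (1 ⊗ₜ cl m)) : f = g := by
  refine LinearMap.ext fun x => ?_
  induction x using scalar_ind with
  | h r m =>
    have : r ⊗ₜ[ℤ] cl m = r • ((1 : R) ⊗ₜ[ℤ] cl m) := by simp [TensorProduct.smul_tmul']
    rw [this, map_smul, map_smul, h]
  | hadd x y hx hy => rw [map_add, map_add, hx, hy]

variable {G H : Type u} [Group G] [Group H]

/-- The class of a finite `G`-set in `RB(G)`. -/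
def GSet.brack (U : GSet G) : RBurnside G R := 1 ⊗ₜ cl U.cls

variable {R} in
theorem burnside_hom_ext {f g : RBurnside G R →ₗ[R] A}
    (h : ∀ U : GSet G, f (U.brack R) = g (U.brack R)) : f = g :=
  scalar_hom_ext fun m => by
    induction m using GSetClass.ind with | h U => exact h U

theorem brack_congr {U V : GSet G} (e : U ≃ V) (h : ∀ (g : G) (x : U), e (g • x) = g • e x) :
    U.brack R = V.brack R := by
  rw [GSet.brack, GSet.cls_eq e h, GSet.brack]

theorem brack_prod (U V : GSet G) : (U.prod V).brack R = U.brack R * V.brack R := by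
  rw [GSet.brack, GSet.brack, GSet.brack, Algebra.TensorProduct.tmul_mul_tmul, one_mul]
  congr 1
  exact (grLift₂_cl (AddMonoidHom.mul (R := GSetClass G)) U.cls V.cls).symm

theorem brack_point : (GSet.point : GSet G).brack R = 1 := rfl

theorem mark_brack (L : Subgroup G) (U : GSet G) :
    mark R L (U.brack R) = (Nat.card (MulAction.fixedPoints L U) : R) := by
  rw [mark, GSet.brack, LinearMap.liftBaseChange_tmul, one_smul]
  exact lift_cl _ _

theorem mark_one (L : Subgroup G) : mark R L 1 = 1 := by
  rw [← brack_point, mark_brack]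
  have : MulAction.fixedPoints L (GSet.point : GSet G) = Set.univ :=
    Set.eq_univ_of_forall fun _ _ => rfl
  rw [this]
  have : Nat.card (Set.univ : Set (GSet.point : GSet G)) = 1 := by
    rw [Nat.card_univ]; exact Nat.card_unique (α := PUnit.{u + 1})
  rw [this, Nat.cast_one]

/-- Fixed points of a product are pairs of fixed points; bilinearity extends this from $G$-sets to
$RB(G)$. -/
theorem mark_mul (L : Subgroup G) (x y : RBurnside G R) :
    mark R L (x * y) = mark R L x * mark R L y := by
  have : (LinearMap.mul R (RBurnside G R)).compr₂ (mark R L) =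
      (LinearMap.mul R R).compl₁₂ (mark R L) (mark R L) := by
    refine burnside_hom_ext fun U => burnside_hom_ext fun V => ?_
    simp only [LinearMap.compr₂_apply, LinearMap.mul_apply', LinearMap.compl₁₂_apply,
      ← brack_prod, mark_brack, ← Nat.cast_mul]
    rw [← Nat.card_prod]
    refine congrArg Nat.cast (Nat.card_congr ?_)
    exact
      { toFun := fun x => (⟨x.1.1, fun l => congrArg Prod.fst (x.2 l)⟩,
          ⟨x.1.2, fun l => congrArg Prod.snd (x.2 l)⟩)
        invFun := fun x => ⟨(x.1.1, x.2.1), fun l => Prod.ext (x.1.2 l) (x.2.2 l)⟩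
        left_inv := fun _ => rfl
        right_inv := fun _ => rfl }
  exact LinearMap.congr_fun₂ this x y

variable {p : ℕ}

/-- The linear map `RB(G) → RB(H)` induced by a class of `(H, G)`-bisets. -/
def actLin (a : BifreeClass H G p) : RBurnside G R →ₗ[R] RBurnside H R :=
  scalarLift₂ R actHom (1 ⊗ₜ cl a)

theorem actLin_brack (X : Biset H G) (hX : X.IsBifree p) (U : GSet G) :
    actLin R (X.cls hX) (U.brack R) = (X.act U).brack R := by
  rw [actLin, GSet.brack, scalarLift₂_tmul, one_mul]; rfl

theorem actLin_add (a b : BifreeClass H G p) : actLin R (a + b) = actLin R a + actLin R b := by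
  rw [actLin, map_add, TensorProduct.tmul_add, map_add]; rfl

end Linear

/-! ### The bisets attached to a group homomorphism -/

section HomBiset

theorem coprime_card_ker_of_injective {G H : Type*} [Group G] [Group H] {f : G →* H} {p : ℕ}
    (hf : Function.Injective f) :
    (Nat.card f.ker).Coprime p := by
  rw [(MonoidHom.ker_eq_bot_iff f).2 hf]; simp

variable {G H : Type u} [Group G] [Group H] [Finite H] (f : G →* H)

/-- `H` as a `(G, H)`-biset, through `f : G → H`. -/
def pullBiset : Biset G H where
  carrier := H
  left := MulAction.compHom H f
  comm := letI := MulAction.compHom H f; ⟨fun g h x => (mul_assoc (f g) x h.unop).symm⟩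

/-- `H` as an `(H, G)`-biset, through `f : G → H`. -/
def pushBiset : Biset H G where
  carrier := H
  right := MulAction.compHom H (MonoidHom.op f)
  comm := letI := MulAction.compHom H (MonoidHom.op f)
    ⟨fun h g x => (mul_assoc h x (f g.unop)).symm⟩

theorem pushBiset_right (g : G) (h : H) :
    (op g • (show pushBiset f from h) : pushBiset f) = (h * f g : H) := rfl

variable {f} {p : ℕ}

theorem pullBiset_isBifree (hf : (Nat.card f.ker).Coprime p) : (pullBiset f).IsBifree p := by
  intro (x : H)
  constructor
  · have : MulAction.stabilizer G (show pullBiset f from x) = f.ker := by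
      ext g
      rw [MulAction.mem_stabilizer_iff, MonoidHom.mem_ker]
      exact mul_eq_right (M := H)
    exact this ▸ hf
  · exact (Biset.isBifree_id (G := H) p x).2

theorem pushBiset_isBifree (hf : (Nat.card f.ker).Coprime p) : (pushBiset f).IsBifree p := by
  intro (x : H)
  constructor
  · exact (Biset.isBifree_id (G := H) p x).1
  · have : MulAction.stabilizer Gᵐᵒᵖ (show pushBiset f from x) = f.ker.op := by
      ext g
      rw [MulAction.mem_stabilizer_iff, Subgroup.mem_op, MonoidHom.mem_ker]
      exact mul_eq_left (M := H)
    have h2 : Nat.card f.ker.op = Nat.card f.ker := (Nat.card_congr f.ker.equivOp).symm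
    exact this ▸ h2 ▸ hf

variable (R : Type v) [CommRing R]

/-- $H\times_H U$ is $U$ with $G$ acting through $f$. The two uses are restriction, with $f$ an
inclusion, and inflation, with $f$ surjective. -/
theorem mark_pullBiset (hf : (pullBiset f).IsBifree p) (L : Subgroup G) (x : RBurnside H R) :
    mark R L (actLin R ((pullBiset f).cls hf) x) = mark R (L.map f) x := by
  have : mark R L ∘ₗ actLin R ((pullBiset f).cls hf) = mark R (L.map f) := by
    refine burnside_hom_ext fun U => ?_
    rw [LinearMap.comp_apply, actLin_brack, mark_brack, mark_brack]
    refine congrArg Nat.cast (Nat.card_congr (Equiv.subtypeEquiv (Tens.idLeft H U) fun t => ?_))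
    change (∀ l : L, _) ↔ ∀ l : L.map f, _
    have key (l : G) : (Tens.idLeft H U) (l • (show (pullBiset f).act U from t)) =
        f l • Tens.idLeft H U t := by
      induction t using Tens.ind with
      | h x u => exact mul_smul (f l) x u
    constructor
    · rintro h ⟨_, l, hl, rfl⟩
      exact (key l).symm.trans (congrArg _ (h ⟨l, hl⟩))
    · intro h l
      refine (Tens.idLeft H U).injective ((key l).trans ?_)
      exact h ⟨f l, l, l.2, rfl⟩
  exact LinearMap.congr_fun this x

end HomBiset


/-! ### Transitive `G`-sets and orbit decomposition -/

section Orbits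

variable {G : Type u} [Group G]

/-- The transitive `G`-set `G / X`. -/
def GSet.quot [Finite G] (X : Subgroup G) : GSet G where
  carrier := G ⧸ X

/-- A stable subset of a `G`-set. -/
def GSet.sub (U : GSet G) (S : Set U) (hS : ∀ (g : G), ∀ x ∈ S, g • x ∈ S) : GSet G where
  carrier := S
  act :=
    { smul := fun g x => ⟨g • x.1, hS g x.1 x.2⟩
      one_smul := fun x => Subtype.ext (one_smul G x.1)
      mul_smul := fun g h x => Subtype.ext (mul_smul g h x.1) }

theorem compl_stable {A X : Type*} [Group A] [MulAction A X] {S : Set X}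
    (hS : ∀ (g : A), ∀ x ∈ S, g • x ∈ S) (g : A) (x : X) (hx : x ∈ Sᶜ) : g • x ∈ Sᶜ :=
  fun h => hx (by simpa using hS g⁻¹ _ h)

open Classical in
theorem GSet.cls_eq_sub_add (U : GSet G) (S : Set U) (hS : ∀ (g : G), ∀ x ∈ S, g • x ∈ S) :
    U.cls = (U.sub S hS).cls + (U.sub Sᶜ (compl_stable hS)).cls := by
  symm
  refine GSet.cls_eq (X := (U.sub S hS).sum (U.sub Sᶜ (compl_stable hS))) (Y := U)
    (Equiv.Set.sumCompl S) ?_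
  rintro g (x | x) <;> rfl

/-- A property of classes of finite `G`-sets that is additive and holds for transitive `G`-sets
holds for all finite `G`-sets. -/
@[elab_as_elim]
theorem GSetClass.orbit_induction [Finite G] {Q : GSetClass G → Prop} (c : GSetClass G)
    (zero : Q 0) (quot : ∀ X : Subgroup G, Q (GSet.quot X).cls)
    (add : ∀ a b, Q a → Q b → Q (a + b)) : Q c := by
  induction c using GSetClass.ind with | h U =>
  induction hn : Nat.card U using Nat.strong_induction_on generalizing U with
  | h n ih =>
  rcases isEmpty_or_nonempty U with h | ⟨⟨u⟩⟩
  · have : U.cls = 0 := GSet.cls_eq (Y := GSet.empty)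
      ((Equiv.equivPEmpty U).trans (Equiv.refl _)) fun _ x => h.elim x
    rwa [this]
  · have hS : ∀ (g : G), ∀ x ∈ MulAction.orbit G u, g • x ∈ MulAction.orbit G u :=
      fun g x hx => (MulAction.mem_orbit_of_mem_orbit g hx)
    rw [U.cls_eq_sub_add _ hS]
    refine add _ _ ?_ (ih _ ?_ _ rfl)
    · have : (U.sub _ hS).cls = (GSet.quot (MulAction.stabilizer G u)).cls := by
        symm
        refine GSet.cls_eq (X := GSet.quot (MulAction.stabilizer G u)) (Y := U.sub _ hS)
          (MulAction.orbitEquivQuotientStabilizer G u).symm fun g x => ?_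
        induction x using QuotientGroup.induction_on with
        | H x => exact Subtype.ext (mul_smul g x u)
      rw [this]
      exact quot _
    · rw [← hn]
      exact Finite.card_subtype_lt (p := (· ∈ (MulAction.orbit G u)ᶜ)) (x := u)
        fun h => h (MulAction.mem_orbit_self u)

end Orbits

/-! ### Restriction, induction and the Frobenius formula -/

section Frobenius

variable {G : Type u} [Group G] [Finite G] (R : Type v) [CommRing R] {p : ℕ}

/-- The class of the restriction biset. -/
def resClass (p : ℕ) (X : Subgroup G) : BifreeClass X G p :=
  (pullBiset X.subtype).cls (pullBiset_isBifree
    (coprime_card_ker_of_injective X.subtype_injective))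

/-- The class of the induction biset. -/
def indClass (p : ℕ) (X : Subgroup G) : BifreeClass G X p :=
  (pushBiset X.subtype).cls (pushBiset_isBifree
    (coprime_card_ker_of_injective X.subtype_injective))

theorem mark_resClass (X : Subgroup G) (L : Subgroup X) (x : RBurnside G R) :
    mark R L (actLin R (resClass p X) x) = mark R (L.map X.subtype) x :=
  mark_pullBiset R _ L x

/-- Inducing the restriction of `x` to `X` is multiplication by `[G / X]`. -/
theorem indClass_resClass (X : Subgroup G) (x : RBurnside G R) :
    actLin R (indClass p X) (actLin R (resClass p X) x) = (GSet.quot X).brack R * x := by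
  have : actLin R (indClass p X) ∘ₗ actLin R (resClass p X) =
      LinearMap.mulLeft R ((GSet.quot X).brack R) := by
    refine burnside_hom_ext fun V => ?_
    rw [LinearMap.comp_apply, LinearMap.mulLeft_apply, resClass, indClass, actLin_brack,
      actLin_brack, ← brack_prod]
    -- The map is $(g,v)\mapsto(gX,gv)$, with inverse $(gX,v)\mapsto(g,g^{-1}v)$; `Tens.idLeft`
    -- identifies the restriction with $V$.
    let φ : (pushBiset X.subtype).act ((pullBiset X.subtype).act V) → (GSet.quot X).prod V :=
      Tens.lift (fun g t => ((QuotientGroup.mk (show G from g) : G ⧸ X),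
        (show G from g) • Tens.idLeft G V t)) fun x g t => by
        induction t using Tens.ind with
        | h k v =>
        refine Prod.ext (QuotientGroup.mk_mul_of_mem (s := X) (show G from g) x.2) ?_
        have key (a b : G) : (a * x) • b • v = a • ((x : G) * b) • v := by
          simp only [smul_smul, mul_assoc]
        exact key g k
    have hφ : Function.Bijective φ := by
      constructor
      · intro s s' h
        induction s using Tens.ind with
        | h g t =>
        induction s' using Tens.ind with
        | h g' t' =>
        have h1 := QuotientGroup.eq.1 (congrArg Prod.fst h)
        have h2 : (show G from g) • Tens.idLeft G V t = (show G from g') • Tens.idLeft G V t' :=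
          congrArg Prod.snd h
        -- The element $g^{-1}g'$ of $X$ carries one representative to the other.
        have h3 : g' = op (⟨_, h1⟩ : X) • g := (mul_inv_cancel_left (G := G) g g').symm
        have h4 : t = (⟨_, h1⟩ : X) • t' := by
          apply (Tens.idLeft G V).injective
          induction t' using Tens.ind with
          | h k v =>
          change _ = (((show G from g)⁻¹ * (show G from g')) * (show G from k) : G) • v
          rw [← inv_smul_smul (show G from g) (Tens.idLeft G V t), h2, mul_assoc, mul_smul,
            mul_smul]
          rfl
        rw [h3, h4]
        exact (Tens.mk_smul _ _ _).symm
      · rintro ⟨q, v⟩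
        induction q using QuotientGroup.induction_on with
        | H g =>
        refine ⟨Tens.mk X (show pushBiset X.subtype from g)
          (show (pullBiset X.subtype).act V from Tens.mk G (1 : G) (g⁻¹ • v)), Prod.ext rfl ?_⟩
        change g • (1 : G) • g⁻¹ • v = v
        simp
    refine brack_congr R (Equiv.ofBijective φ hφ) fun g s => ?_
    induction s using Tens.ind with
    | h k t => exact Prod.ext rfl (mul_smul g (show G from k) _)
  exact LinearMap.congr_fun this x

end Frobenius


/-! ### The idempotent `e^G_G` -/

section Idempotent

/-- The type of subgroups of a finite group is a `Fintype`. -/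
abbrev subgroupFintype (G : Type u) [Group G] [Finite G] : Fintype (Subgroup G) :=
  Fintype.ofFinite _

attribute [local instance] subgroupFintype

open Classical in
/-- The coefficient `|X| μ(X, G) / |G|` of `[G / X]` in `e^G_G`. -/
def idemCoeff {G : Type u} [Group G] [Finite G] (X : Subgroup G) : ℚ :=
  letI : LocallyFiniteOrder (Subgroup G) := Fintype.toLocallyFiniteOrder
  (Nat.card G : ℚ)⁻¹ * (Nat.card X * IncidenceAlgebra.mu ℚ X ⊤)

/-- The coset $gX$ is fixed by $L$ exactly when $g^{-1}Lg\le X$, and each coset has $|X|$ elements.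
-/
theorem card_mul_card_fixedPoints_quot {G : Type u} [Group G] (X L : Subgroup G) :
    Nat.card X * Nat.card (MulAction.fixedPoints L (G ⧸ X)) =
      Nat.card {g : G // L.map (MulAut.conj g⁻¹).toMonoidHom ≤ X} := by
  rw [← Nat.card_prod, ← Nat.card_congr (QuotientGroup.preimageMkEquivSubgroupProdSet X _)]
  refine Nat.card_congr (Equiv.subtypeEquivRight fun g => ?_)
  rw [Set.mem_preimage, Subgroup.map_le_iff_le_comap, MulAction.mem_fixedPoints, SetLike.le_def,
    Subtype.forall]
  refine forall₂_congr fun l hl => ?_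
  change ((l * g : G) : G ⧸ X) = (g : G ⧸ X) ↔ _
  rw [eq_comm, QuotientGroup.eq, Subgroup.mem_comap]
  simp [mul_assoc]

theorem card_lt_card_group {G : Type u} [Group G] [Finite G] {X : Subgroup G} (hX : X ≠ ⊤) :
    Nat.card X < Nat.card G :=
  lt_of_le_of_ne (Subgroup.card_le_card_group X) fun h => hX (Subgroup.eq_top_of_card_eq X h)

theorem map_subtype_ne_top {G : Type u} [Group G] {X : Subgroup G} (hX : X ≠ ⊤) (L : Subgroup X) :
    L.map X.subtype ≠ ⊤ := fun h =>
  hX (top_le_iff.1 (h ▸ Subgroup.map_subtype_le L))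

theorem brack_quot_top  (K : Type v) [CommRing K] {G : Type u} [Group G] [Finite G] :
    (GSet.quot (⊤ : Subgroup G)).brack K = 1 := by
  rw [← brack_point]
  have : Subsingleton (G ⧸ (⊤ : Subgroup G)) := QuotientGroup.subsingleton_quotient_top
  exact brack_congr K (U := GSet.quot (⊤ : Subgroup G)) (V := GSet.point)
    ⟨fun _ => PUnit.unit, fun _ => QuotientGroup.mk (1 : G), fun _ => this.elim _ _, fun _ => rfl⟩
    fun _ _ => rfl

section

variable {G : Type u} [Group G] [Finite G]

theorem idemCoeff_top : idemCoeff (⊤ : Subgroup G) = 1 := by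
  simp [idemCoeff]

open Classical in
-- This puts $m_{G,N}$ in the shape produced by `map_topIdem`: a linear functional whose value on
-- $[G/X]$ is the indicator of $XN=G$.
theorem deflationNumber_eq (N : Subgroup G) :
    deflationNumber G N = ∑ X : Subgroup G, idemCoeff X * if X ⊔ N = ⊤ then 1 else 0 := by
  simp only [deflationNumber, idemCoeff, Finset.mul_sum, Finset.sum_filter, mul_ite, mul_one,
    mul_zero]

open Classical in
-- Gluck's formula, read at the mark $L$. The factor $|X|$ turns fixed cosets into elements $g$ with
-- $L^g\le X$. After exchanging the sums, the inner sum $\sum_{X\ge L^g}\mu(X,G)$ vanishes unless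
-- $L^g=G$, by the defining property of $\mu$; the outer sum over $g$ cancels $|G|^{-1}$.
theorem sum_idemCoeff_mul_card_fixedPoints (L : Subgroup G) :
    ∑ X : Subgroup G, idemCoeff X * (Nat.card (MulAction.fixedPoints L (G ⧸ X)) : ℚ) =
      if L = ⊤ then 1 else 0 := by
  let _ : LocallyFiniteOrder (Subgroup G) := Fintype.toLocallyFiniteOrder
  let _ : Fintype G := Fintype.ofFinite G
  have h1 (X : Subgroup G) : idemCoeff X * (Nat.card (MulAction.fixedPoints L (G ⧸ X)) : ℚ) =
      (Nat.card G : ℚ)⁻¹ * ∑ g : G, if L.map (MulAut.conj g⁻¹).toMonoidHom ≤ X then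
        IncidenceAlgebra.mu ℚ X ⊤ else 0 := by
    rw [idemCoeff, mul_assoc, mul_right_comm, ← Nat.cast_mul, card_mul_card_fixedPoints_quot,
      Nat.card_eq_fintype_card (α := {g : G // _}), Fintype.card_subtype, ← Finset.sum_filter, Finset.sum_const,
      nsmul_eq_mul]
  have h2 (g : G) : (∑ X : Subgroup G, if L.map (MulAut.conj g⁻¹).toMonoidHom ≤ X then
        IncidenceAlgebra.mu ℚ X ⊤ else 0) = if L = ⊤ then 1 else 0 := by
    have h3 : L.map (MulAut.conj g⁻¹).toMonoidHom = ⊤ ↔ L = ⊤ := by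
      constructor
      · intro h
        apply Subgroup.map_injective (f := (MulAut.conj g⁻¹).toMonoidHom)
          (MulAut.conj g⁻¹).injective
        rw [h]
        exact (Subgroup.map_top_of_surjective _ (MulAut.conj g⁻¹).surjective).symm
      · rintro rfl
        exact Subgroup.map_top_of_surjective _ (MulAut.conj g⁻¹).surjective
    rw [← Finset.sum_filter, ← if_congr h3 rfl rfl,
      ← IncidenceAlgebra.sum_Icc_mu_left (𝕜 := ℚ)
        (L.map (MulAut.conj g⁻¹).toMonoidHom) ⊤]
    refine Finset.sum_congr ?_ fun _ _ => rfl
    ext X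
    simp
  simp_rw [h1]
  rw [← Finset.mul_sum, Finset.sum_comm]
  simp_rw [h2]
  rw [Finset.sum_const, nsmul_eq_mul, ← mul_assoc, Finset.card_univ, ← Nat.card_eq_fintype_card,
    inv_mul_cancel₀ (Nat.cast_ne_zero.2 Nat.card_pos.ne'), one_mul]

end

variable (K : Type v) [Field K]

/-- The explicit form `|G|⁻¹ ∑_X |X| μ(X, G) [G / X]` of the idempotent `e^G_G`. -/
def topIdem (G : Type u) [Group G] [Finite G] : RBurnside G K :=
  ∑ X : Subgroup G, (idemCoeff X : K) • (GSet.quot X).brack K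

variable {G : Type u} [Group G] [Finite G]

open Classical in
/-- Every `x` is the sum of `e^G_G x` and of elements induced from restrictions of `x` to proper
subgroups. -/
theorem eq_topIdem_mul_add (p : ℕ) (x : RBurnside G K) :
    x = topIdem K G * x - ∑ X : Subgroup G with X ≠ ⊤,
      (idemCoeff X : K) • actLin K (indClass p X) (actLin K (resClass p X) x) := by
  have h : topIdem K G = 1 + ∑ X : Subgroup G with X ≠ ⊤,
      (idemCoeff X : K) • (GSet.quot X).brack K := by
    rw [topIdem, ← Finset.add_sum_erase _ _ (Finset.mem_univ ⊤), idemCoeff_top, brack_quot_top,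
      Rat.cast_one, one_smul]
    congr 2
    ext X; simp
  simp_rw [indClass_resClass]
  rw [h, add_mul, one_mul, Finset.sum_mul]
  simp_rw [smul_mul_assoc]
  rw [add_sub_cancel_right]

/-- Multiplication by $e^G_G$ is a combination of actions of bifree bisets, so it preserves every
subfunctor. -/
theorem topIdem_mul_eq (p : ℕ) (x : RBurnside G K) :
    topIdem K G * x = ∑ X : Subgroup G,
      (idemCoeff X : K) • actLin K (indClass p X) (actLin K (resClass p X) x) := by
  simp_rw [indClass_resClass]
  rw [topIdem, Finset.sum_mul]
  simp_rw [smul_mul_assoc]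

variable [CharZero K]

/-- Evaluation of a linear functional, rational on transitive `G`-sets, at `e^G_G`. -/
theorem map_topIdem (f : RBurnside G K →ₗ[K] K)
    (c : Subgroup G → ℚ) (hc : ∀ X, f ((GSet.quot X).brack K) = (c X : K)) :
    f (topIdem K G) = ((∑ X : Subgroup G, idemCoeff X * c X : ℚ) : K) := by
  rw [topIdem, map_sum, Rat.cast_sum]
  refine Finset.sum_congr rfl fun X _ => ?_
  rw [map_smul, hc, smul_eq_mul, Rat.cast_mul]

open Classical in
theorem mark_topIdem (L : Subgroup G) :
    mark K L (topIdem K G) = if L = ⊤ then 1 else 0 := by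
  rw [map_topIdem K (mark K L) (fun X => Nat.card (MulAction.fixedPoints L (G ⧸ X))),
    sum_idemCoeff_mul_card_fixedPoints]
  · split_ifs <;> simp
  · intro X
    rw [mark_brack, Rat.cast_natCast]; rfl

/-- The hypothesis `ih`, separation by marks on proper subgroups, lets this serve inside the
induction that proves separation for $G$. On $[G/X]$ with $X$ proper, the product is induced from
the restriction of $e^G_G$ to $X$, whose marks all vanish. -/
theorem topIdem_mul_of_ext
    (ih : ∀ X : Subgroup G, X ≠ ⊤ → ∀ x : RBurnside X K, (∀ L, mark K L x = 0) → x = 0)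
    (x : RBurnside G K) : topIdem K G * x = mark K ⊤ x • topIdem K G := by
  classical
  have : LinearMap.mulLeft K (topIdem K G) = (mark K ⊤).smulRight (topIdem K G) := by
    refine scalar_hom_ext fun c => ?_
    induction c using GSetClass.orbit_induction with
    | zero => simp
    | add a b ha hb => simp only [map_add, TensorProduct.tmul_add, ha, hb]
    | quot X =>
      change topIdem K G * (GSet.quot X).brack K =
        mark K ⊤ ((GSet.quot X).brack K) • topIdem K G
      by_cases hX : X = ⊤
      · rw [hX, brack_quot_top, mark_one, one_smul, mul_one]
      · have h0 : topIdem K G * (GSet.quot X).brack K = 0 := by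
          -- Induction and restriction bisets are bifree for every $p$; the value $1$ is an
          -- arbitrary choice.
          rw [mul_comm, ← indClass_resClass K (p := 1), ih X hX (actLin K _ _), map_zero]
          intro L
          rw [mark_resClass, mark_topIdem, if_neg (map_subtype_ne_top hX L)]
        have h1 := mark_mul K ⊤ (topIdem K G) ((GSet.quot X).brack K)
        rw [h0, mark_topIdem, if_pos rfl, one_mul, map_zero] at h1
        rw [h0, ← h1, zero_smul]
  exact LinearMap.congr_fun this x

/-- The marks separate the elements of `KB(G)`. -/
theorem eq_zero_of_mark_eq_zero {x : RBurnside G K} (hx : ∀ L, mark K L x = 0) : x = 0 := by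
  classical
  induction hn : Nat.card G using Nat.strong_induction_on generalizing G with
  | h n ih =>
  have ih' (X : Subgroup G) (hX : X ≠ ⊤) (x : RBurnside X K) (hx : ∀ L, mark K L x = 0) : x = 0 :=
    ih _ (hn ▸ card_lt_card_group hX) hx rfl
  -- The term $e^G_G\,x$ dies because the mark of $x$ at $G$ is zero; the other terms come from
  -- restrictions to proper subgroups, which vanish by induction.
  rw [eq_topIdem_mul_add K 1 x, topIdem_mul_of_ext K ih', hx, zero_smul, zero_sub, neg_eq_zero]
  refine Finset.sum_eq_zero fun X hX => ?_
  rw [ih' X (by simpa using hX) (actLin K (resClass 1 X) x), map_zero, smul_zero]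
  intro L
  rw [mark_resClass, hx]

theorem topIdem_mul (x : RBurnside G K) : topIdem K G * x = mark K ⊤ x • topIdem K G :=
  topIdem_mul_of_ext K (fun _ _ _ => eq_zero_of_mark_eq_zero K) x

theorem resClass_topIdem (p : ℕ) {X : Subgroup G} (hX : X ≠ ⊤) :
    actLin K (resClass p X) (topIdem K G) = 0 := by
  classical
  refine eq_zero_of_mark_eq_zero K fun L => ?_
  rw [mark_resClass, mark_topIdem, if_neg (map_subtype_ne_top hX L)]

theorem mark_top_topIdem : mark K ⊤ (topIdem K G) = 1 := by
  classical rw [mark_topIdem, if_pos rfl]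

theorem topIdem_ne_zero : topIdem K G ≠ 0 := fun h => by
  have := mark_top_topIdem K (G := G)
  rw [h, map_zero] at this
  exact zero_ne_one this

theorem isIdempotentElem_topIdem : IsIdempotentElem (topIdem K G) := by
  rw [IsIdempotentElem, topIdem_mul, mark_top_topIdem, one_smul]

/-- The ideal generated by $e^G_G$ is the line $\mathbb K e^G_G$, so both orthogonal summands are
multiples of $e^G_G$, and one of the two scalars must vanish. -/
theorem isPrimitiveIdempotent_topIdem : IsPrimitiveIdempotent (topIdem K G) := by
  refine ⟨isIdempotentElem_topIdem K, topIdem_ne_zero K, fun a b ha hb hab h => ?_⟩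
  have ha' : a = mark K ⊤ a • topIdem K G := by
    rw [← topIdem_mul, ← h, add_mul, ha, mul_comm b, hab, add_zero]
  have hb' : b = mark K ⊤ b • topIdem K G := by
    rw [← topIdem_mul, ← h, add_mul, hb, hab, zero_add]
  have h0 := mark_mul K ⊤ a b
  rw [hab, map_zero] at h0
  rcases mul_eq_zero.1 h0.symm with h0 | h0
  · left; rw [ha', h0, zero_smul]
  · right; rw [hb', h0, zero_smul]

/-- The chosen $e$ has mark $1$ at $G$, so $e^G_G\,e=e^G_G$. Then $e=e^G_G+(e-e^G_G)$ is an
orthogonal decomposition, and primitivity of $e$ kills the second summand. -/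
theorem burnsideIdempotent_top : burnsideIdempotent K (⊤ : Subgroup G) = topIdem K G := by
  obtain ⟨⟨h1, -, h3⟩, h4⟩ := Classical.epsilon_spec
    (p := fun e : RBurnside G K => IsPrimitiveIdempotent e ∧ mark K ⊤ e = 1)
    ⟨_, isPrimitiveIdempotent_topIdem K, mark_top_topIdem K⟩
  rw [← burnsideIdempotent] at h1 h3 h4
  set e := burnsideIdempotent K (⊤ : Subgroup G)
  have he : topIdem K G * e = topIdem K G := by rw [topIdem_mul, h4, one_smul]
  have hi := isIdempotentElem_topIdem K (G := G)
  have h5 : IsIdempotentElem (e - topIdem K G) := by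
    rw [IsIdempotentElem, sub_mul, mul_sub, mul_sub, h1, hi, he, mul_comm e, he, sub_self, sub_zero]
  have h6 : topIdem K G * (e - topIdem K G) = 0 := by rw [mul_sub, he, hi, sub_self]
  exact (sub_eq_zero.1 ((h3 _ _ hi h5 h6 (add_sub_cancel _ _)).resolve_left
    (topIdem_ne_zero K)))

end Idempotent


/-! ### Deflation of `e^G_G` -/

section Deflation

variable {G H : Type u} [Group G] [Group H]

/-- The stabilizer of a point for a right action. -/
def rightStab {X : Type*} [MulAction Hᵐᵒᵖ X] (x : X) : Subgroup H :=
  (MulAction.stabilizer Hᵐᵒᵖ x).unop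

theorem mem_rightStab {X : Type*} [MulAction Hᵐᵒᵖ X] {x : X} {h : H} :
    h ∈ rightStab x ↔ op h • x = x := Iff.rfl

theorem card_rightStab {X : Type*} [MulAction Hᵐᵒᵖ X] (x : X) :
    Nat.card (rightStab (H := H) x) = Nat.card (MulAction.stabilizer Hᵐᵒᵖ x) :=
  Nat.card_congr (rightStab (H := H) x).equivOp

variable {X : Biset G H} {x : X}

/-- Right translation of $x$ by $h$ agrees with a left translation, and left translations preserve
right stabilizers. -/
theorem rightStab_normal (hl : ∀ h : H, ∃ g : G, g • x = op h • x) :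
    (rightStab (H := H) x).Normal := by
  refine ⟨fun m hm h => ?_⟩
  obtain ⟨g, hg⟩ := hl h
  rw [mem_rightStab] at hm ⊢
  rw [op_mul, op_mul, mul_smul, mul_smul, ← hg, ← smul_comm g (op m) x, hm, hg, smul_smul, ← op_mul,
    mul_inv_cancel, op_one, one_smul]

open Classical in
-- Let $M$ be the right stabilizer of $x$, normal by `hl`. By `hr`, $X\cong M\backslash H$, so
-- $X\times_H(H/Y)$ is $H/MY$, on which $G$ is transitive by `hl`. A fixed point exists only if this
-- set is a single point.
theorem card_fixedPoints_act_quot [Finite H] (hl : ∀ h : H, ∃ g : G, g • x = op h • x)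
    (hr : ∀ y : X, ∃ h : H, y = op h • x) (Y : Subgroup H) :
    Nat.card (MulAction.fixedPoints (⊤ : Subgroup G) (X.act (GSet.quot Y))) =
      if Y ⊔ rightStab (H := H) x = ⊤ then 1 else 0 := by
  have hM := rightStab_normal hl
  have hmk (t : X.act (GSet.quot Y)) :
      ∃ a : H, t = Tens.mk H x (show GSet.quot Y from (a : H ⧸ Y)) := by
    induction t using Tens.ind with
    | h y q =>
    induction q using QuotientGroup.induction_on with
    | H a =>
    obtain ⟨h, rfl⟩ := hr y
    exact ⟨h * a, Tens.mk_smul h x (show GSet.quot Y from (a : H ⧸ Y))⟩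
  split_ifs with hY
  · have h1 (t : X.act (GSet.quot Y)) :
        t = Tens.mk H x (show GSet.quot Y from ((1 : H) : H ⧸ Y)) := by
      obtain ⟨a, rfl⟩ := hmk t
      have ha : a ∈ ((rightStab (H := H) x ⊔ Y : Subgroup H) : Set H) := by
        rw [sup_comm, hY]; trivial
      rw [Subgroup.normal_mul] at ha
      obtain ⟨m, hm, y, hy, rfl⟩ := ha
      have h2 : (show GSet.quot Y from ((m * y : H) : H ⧸ Y)) =
          m • (show GSet.quot Y from ((1 : H) : H ⧸ Y)) := by
        change ((m * y : H) : H ⧸ Y) = ((m * 1 : H) : H ⧸ Y)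
        rw [QuotientGroup.eq]
        simpa using hy
      change Tens.mk H x (show GSet.quot Y from ((m * y : H) : H ⧸ Y)) = _
      rw [h2, ← Tens.mk_smul, mem_rightStab.1 hm]
    rw [Nat.card_eq_one_iff_unique]
    exact ⟨⟨fun s t => Subtype.ext ((h1 _).trans (h1 _).symm)⟩,
      ⟨⟨Tens.mk H x (show GSet.quot Y from ((1 : H) : H ⧸ Y)), fun g => h1 _⟩⟩⟩
  · rw [Nat.card_eq_zero]
    refine Or.inl ⟨fun ⟨t, ht⟩ => hY ?_⟩
    obtain ⟨a, rfl⟩ := hmk t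
    refine top_le_iff.1 fun b _ => ?_
    -- With this conjugate, $g$ sends the class of $(x,aY)$ to that of $(x,abY)$; equality of the
    -- two classes then places $b$ in $MY$.
    obtain ⟨g, hg⟩ := hl (a * b * a⁻¹)
    have h1 : Tens.mk H (g • x) (show GSet.quot Y from (a : H ⧸ Y)) =
        Tens.mk H x (show GSet.quot Y from (a : H ⧸ Y)) := ht ⟨g, trivial⟩
    rw [hg, Tens.mk_smul] at h1
    obtain ⟨k, hk, hk'⟩ := Tens.exact h1
    have h2 : ((a : H) : H ⧸ Y) = ((k * (a * b * a⁻¹ * a) : H) : H ⧸ Y) := hk'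
    rw [QuotientGroup.eq] at h2
    have h3 : a⁻¹ * k * a ∈ rightStab (H := H) x := by
      simpa using hM.conj_mem k hk.symm a⁻¹
    have h4 : b = (a⁻¹ * k * a)⁻¹ * (a⁻¹ * (k * (a * b * a⁻¹ * a))) := by group
    rw [h4]
    exact mul_mem (inv_mem (Subgroup.mem_sup_right h3)) (Subgroup.mem_sup_left h2)

/-- On $[H/Y]$ this functional is the indicator of $YM=H$, where $M$ is the right stabilizer;
weighting by the coefficients of $e^H_H$ gives the definition of $m_{H,M}$. -/
theorem mark_act_topIdem [Finite H] {p : ℕ} (K : Type v) [Field K] [CharZero K]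
    (hX : X.IsBifree p) (hl : ∀ h : H, ∃ g : G, g • x = op h • x)
    (hr : ∀ y : X, ∃ h : H, y = op h • x) :
    mark K ⊤ (actLin K (X.cls hX) (topIdem K H)) =
      (deflationNumber H (rightStab (H := H) x) : K) := by
  classical
  rw [← LinearMap.comp_apply, deflationNumber_eq]
  refine map_topIdem K _ _ fun Y => ?_
  rw [LinearMap.comp_apply, actLin_brack, mark_brack, card_fixedPoints_act_quot hl hr]
  split_ifs <;> simp

theorem mark_deflation_topIdem [Finite G] {p : ℕ} (K : Type v) [Field K] [CharZero K]
    (N : Subgroup G) [N.Normal] (hN : (pushBiset (QuotientGroup.mk' N)).IsBifree p) :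
    mark K ⊤ (actLin K ((pushBiset (QuotientGroup.mk' N)).cls hN) (topIdem K G)) =
      (deflationNumber G N : K) := by
  have h1 : rightStab (H := G) (show pushBiset (QuotientGroup.mk' N) from (1 : G ⧸ N)) = N := by
    ext g
    rw [mem_rightStab, pushBiset_right]
    exact (Eq.congr (one_mul (QuotientGroup.mk' N g)) rfl).trans
      (QuotientGroup.eq_one_iff (N := N) g)
  rw [mark_act_topIdem (x := show pushBiset (QuotientGroup.mk' N) from (1 : G ⧸ N)) K hN, h1]
  · exact fun g => ⟨QuotientGroup.mk' N g, (mul_one (QuotientGroup.mk' N g)).trans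
      (one_mul (QuotientGroup.mk' N g)).symm⟩
  · intro y
    obtain ⟨g, hg⟩ := QuotientGroup.mk'_surjective N y
    exact ⟨g, hg.symm.trans (one_mul (QuotientGroup.mk' N g)).symm⟩

end Deflation

/-! ### Transitive bisets acting on `e^H_H` -/

section Transitive

variable {G H : Type u} [Group G] [Group H]

/-- A stable subset of a biset. -/
def Biset.sub (X : Biset G H) (S : Set X) (hl : ∀ (g : G), ∀ x ∈ S, g • x ∈ S)
    (hr : ∀ (h : Hᵐᵒᵖ), ∀ x ∈ S, h • x ∈ S) : Biset G H where
  carrier := S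
  left :=
    { smul := fun g x => ⟨g • x.1, hl g x.1 x.2⟩
      one_smul := fun x => Subtype.ext (one_smul G x.1)
      mul_smul := fun g h x => Subtype.ext (mul_smul g h x.1) }
  right :=
    { smul := fun g x => ⟨g • x.1, hr g x.1 x.2⟩
      one_smul := fun x => Subtype.ext (one_smul Hᵐᵒᵖ x.1)
      mul_smul := fun g h x => Subtype.ext (mul_smul g h x.1) }
  comm := @SMulCommClass.mk _ _ _ (_) (_) fun g h x => Subtype.ext (smul_comm g h x.1)

theorem Biset.IsBifree.sub {p : ℕ} {X : Biset G H} (hX : X.IsBifree p) (S : Set X)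
    (hl : ∀ (g : G), ∀ x ∈ S, g • x ∈ S) (hr : ∀ (h : Hᵐᵒᵖ), ∀ x ∈ S, h • x ∈ S) :
    (X.sub S hl hr).IsBifree p := by
  intro x
  have h₁ : MulAction.stabilizer G x = MulAction.stabilizer G x.1 := by
    ext; exact Subtype.ext_iff
  have h₂ : MulAction.stabilizer Hᵐᵒᵖ x = MulAction.stabilizer Hᵐᵒᵖ x.1 := by
    ext; exact Subtype.ext_iff
  exact ⟨h₁ ▸ (hX x.1).1, h₂ ▸ (hX x.1).2⟩

open Classical in
theorem Biset.cls_eq_sub_add {p : ℕ} {X : Biset G H} (hX : X.IsBifree p) (S : Set X)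
    (hl : ∀ (g : G), ∀ x ∈ S, g • x ∈ S) (hr : ∀ (h : Hᵐᵒᵖ), ∀ x ∈ S, h • x ∈ S) :
    X.cls hX = (X.sub S hl hr).cls (hX.sub S hl hr) +
      (X.sub Sᶜ (compl_stable hl) (compl_stable hr)).cls (hX.sub Sᶜ _ _) := by
  symm
  refine Biset.cls_eq (X := (X.sub S hl hr).sum (X.sub Sᶜ (compl_stable hl) (compl_stable hr)))
    (Y := X) _ _ (Equiv.Set.sumCompl S) ?_ ?_
  · rintro g (x | x) <;> rfl
  · rintro g (x | x) <;> rfl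

variable {X : Biset G H} (x : X)

/-- The elements `h` of `H` such that `x h` lies in the left orbit of `x`. -/
def rightRange : Subgroup H where
  carrier := {h | ∃ g : G, g • x = op h • x}
  one_mem' := ⟨1, by simp⟩
  mul_mem' := by
    rintro a b ⟨g, hg⟩ ⟨k, hk⟩
    exact ⟨g * k, by rw [mul_smul, hk, smul_comm, hg, smul_smul, op_mul]⟩
  inv_mem' := by
    rintro a ⟨g, hg⟩
    refine ⟨g⁻¹, ?_⟩
    rw [inv_smul_eq_iff, smul_comm, hg, smul_smul, ← op_mul, mul_inv_cancel, op_one, one_smul]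

theorem mem_rightRange {h : H} : h ∈ rightRange x ↔ ∃ g : G, g • x = op h • x := Iff.rfl

/-- The left orbit of `x`, as a biset for `G` and the subgroup `rightRange x`. -/
def orbitBiset : Biset G (rightRange x) where
  carrier := MulAction.orbit G x
  right :=
    { smul := fun q y => ⟨op (q.unop : H) • y.1, by
        obtain ⟨_, g, rfl⟩ := y
        obtain ⟨k, hk⟩ := q.unop.2
        exact ⟨g * k, by
          change (g * k) • x = op (q.unop : H) • g • x
          rw [mul_smul, hk, smul_comm]⟩⟩
      one_smul := fun y => Subtype.ext (one_smul Hᵐᵒᵖ y.1)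
      mul_smul := fun a b y => Subtype.ext (mul_smul (op (a.unop : H)) (op (b.unop : H)) y.1) }
  comm := @SMulCommClass.mk _ _ _ (_) (_) fun g q y =>
    Subtype.ext (smul_comm g (op (q.unop : H)) y.1)

/-- A biset that is transitive on the right factors through restriction to `rightRange x`. -/
theorem actLin_eq_orbitBiset [Finite H] {p : ℕ} (R : Type v) [CommRing R] (hX : X.IsBifree p)
    (hY : (orbitBiset x).IsBifree 1) (hr : ∀ y : X, ∃ h : H, y = op h • x) :
    actLin R (X.cls hX) =
      actLin R ((orbitBiset x).cls hY) ∘ₗ actLin R (resClass 1 (rightRange x)) := by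
  refine burnside_hom_ext fun U => ?_
  rw [LinearMap.comp_apply, resClass, actLin_brack, actLin_brack, actLin_brack]
  symm
  have hid (q : rightRange x) (t : (pullBiset (rightRange x).subtype).act U) :
      Tens.idLeft H U (q • t) = (q : H) • Tens.idLeft H U t := by
    induction t using Tens.ind with
    | h k u => exact mul_smul (q : H) (show H from k) u
  let φ : (orbitBiset x).act ((pullBiset (rightRange x).subtype).act U) → X.act U :=
    Tens.lift (fun y t => Tens.mk H y.1 (Tens.idLeft H U t)) fun q y t =>
      (Tens.mk_smul (q : H) y.1 (Tens.idLeft H U t)).trans (congrArg _ (hid q t).symm)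
  let x₀ : orbitBiset x := ⟨x, MulAction.mem_orbit_self x⟩
  -- A point $y$ of the left orbit is $xh$ by `hr`, and then $h$ lies in `rightRange x`; so $y$ can
  -- be moved to $x$ by passing $h$ across the product.
  have hmk (s : (orbitBiset x).act ((pullBiset (rightRange x).subtype).act U)) :
      ∃ t, s = Tens.mk (rightRange x) x₀ t := by
    induction s using Tens.ind with
    | h y t =>
    obtain ⟨h, hh⟩ := hr y.1
    obtain ⟨g, hg⟩ := y.2
    have hy : y = op (⟨h, g, hg.trans hh⟩ : rightRange x) • x₀ := Subtype.ext hh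
    exact ⟨_, by rw [hy, Tens.mk_smul]⟩
  have hφ : Function.Bijective φ := by
    constructor
    · intro s s' hs
      obtain ⟨t, rfl⟩ := hmk s
      obtain ⟨t', rfl⟩ := hmk s'
      obtain ⟨h, h1, h2⟩ := Tens.exact (G := H) hs
      have hq : h ∈ rightRange x := ⟨1, (one_smul G x).trans h1⟩
      have h3 : t' = (⟨h, hq⟩ : rightRange x) • t :=
        (Tens.idLeft H U).injective (h2.trans (hid ⟨h, hq⟩ t).symm)
      have h4 : x₀ = op (⟨h, hq⟩ : rightRange x) • x₀ := Subtype.ext h1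
      rw [h3, ← Tens.mk_smul, ← h4]
    · intro s
      induction s using Tens.ind with
      | h y u =>
      obtain ⟨h, rfl⟩ := hr y
      refine ⟨Tens.mk (rightRange x) x₀
        (show (pullBiset (rightRange x).subtype).act U from (Tens.idLeft H U).symm (h • u)), ?_⟩
      change Tens.mk H x (Tens.idLeft H U ((Tens.idLeft H U).symm (h • u))) = _
      rw [Equiv.apply_symm_apply]
      exact (Tens.mk_smul h x u).symm
  refine brack_congr R (Equiv.ofBijective φ hφ) fun g s => ?_
  induction s using Tens.ind with
  | h y t => rfl

end Transitive


/-! ### Bisets with non-zero mark on $e^H_H$ come from surjections -/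

section Dominates

variable {p : ℕ} {G H : FiniteGrp.{u}}

/-- If the left action on `x` is given by a right action of `H` which is free at `x`, then it is
given by a homomorphism `G → H`. -/
theorem dominates_of_rightStab_eq_bot {X : Biset G H} (hX : X.IsBifree p) {x : X}
    (hg : ∀ g : G, ∃ h : H, g • x = op h • x) (hl : ∀ h : H, ∃ g : G, g • x = op h • x)
    (hx : rightStab (H := H) x = ⊥) : Dominates p G H := by
  choose f hf using hg
  have huniq (a b : H) (h : op a • x = op b • x) : a = b := by
    have : a * b⁻¹ ∈ rightStab (H := H) x := by
      rw [mem_rightStab, op_mul, mul_smul, h, smul_smul, ← op_mul, mul_inv_cancel, op_one, one_smul]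
    rw [hx, Subgroup.mem_bot] at this
    exact mul_inv_eq_one.1 this
  -- The two actions commute, so $abx=a(xf(b))=xf(a)f(b)$: the map is a homomorphism, not an
  -- antihomomorphism.
  let F : G →* H := MonoidHom.mk' f fun a b => huniq _ _ (by
    rw [← hf, mul_smul, hf b, smul_comm, hf a, smul_smul, op_mul])
  have hF : Function.Surjective F := fun h => by
    obtain ⟨g, hg⟩ := hl h
    exact ⟨g, huniq _ _ ((hf g).symm.trans hg)⟩
  have hker : F.ker = MulAction.stabilizer G x := by
    ext g
    rw [MonoidHom.mem_ker, MulAction.mem_stabilizer_iff, hf]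
    constructor
    · intro h
      rw [show f g = 1 from h, op_one, one_smul]
    · intro h
      exact huniq (f g) 1 (by rw [op_one, one_smul, h])
  exact ⟨F.ker, inferInstance, hker ▸ (hX x).1,
    ⟨QuotientGroup.quotientKerEquivOfSurjective F hF⟩⟩

/-- The key converse. A non-zero mark on a transitive piece of $X$ forces $Gx=xH$ for some $x$; the
$B^\Delta_p$ condition then makes the right stabilizer trivial, so the piece is given by a
surjection $G\to H$ whose kernel is the left stabilizer. -/
theorem dominates_of_mark_ne_zero (K : Type v) [Field K] [CharZero K] (hB : IsBDeltaGroup p H)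
    (X : Biset G H) (hX : X.IsBifree p)
    (h : mark K ⊤ (actLin K (X.cls hX) (topIdem K H)) ≠ 0) : Dominates p G H := by
  induction hn : Nat.card X using Nat.strong_induction_on generalizing X with
  | h n ih =>
  -- A proper non-empty stable subset splits $X$ into two smaller bisets, at least one of which
  -- still has non-zero mark.
  by_cases hS : ∃ S : Set X, (∀ (g : G), ∀ x ∈ S, g • x ∈ S) ∧
      (∀ (h : Hᵐᵒᵖ), ∀ x ∈ S, h • x ∈ S) ∧ S.Nonempty ∧ Sᶜ.Nonempty
  · obtain ⟨S, hl, hr, ⟨a, ha⟩, ⟨b, hb⟩⟩ := hS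
    rw [Biset.cls_eq_sub_add hX S hl hr, actLin_add, LinearMap.add_apply, map_add] at h
    by_cases h0 : mark K ⊤ (actLin K ((X.sub S hl hr).cls (hX.sub S hl hr)) (topIdem K H)) = 0
    · rw [h0, zero_add] at h
      exact ih _ (hn ▸ Finite.card_subtype_lt (p := (· ∈ Sᶜ)) (x := a) fun h => h ha) _ _ h rfl
    · exact ih _ (hn ▸ Finite.card_subtype_lt (p := (· ∈ S)) (x := b) hb) _ _ h0 rfl
  · have htr (S : Set X) (hl : ∀ (g : G), ∀ x ∈ S, g • x ∈ S)
        (hr : ∀ (h : Hᵐᵒᵖ), ∀ x ∈ S, h • x ∈ S) (hne : S.Nonempty) (y : X) : y ∈ S := by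
      by_contra hy
      exact hS ⟨S, hl, hr, hne, y, hy⟩
    -- If no $X\times_H U$ had a $G$-fixed point, the mark at $G$ would vanish on the whole image of
    -- $X$. A fixed class $[x,u]$ yields $Gx\subseteq xH$.
    have hfix : ∃ (U : GSet H) (t : X.act U), ∀ g : G, g • t = t := by
      by_contra! hno
      refine h ?_
      have : mark K ⊤ ∘ₗ actLin K (X.cls hX) = 0 := by
        refine burnside_hom_ext fun U => ?_
        rw [LinearMap.comp_apply, actLin_brack, mark_brack, LinearMap.zero_apply, Nat.cast_eq_zero,
          Nat.card_eq_zero]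
        refine Or.inl ⟨fun ⟨t, ht⟩ => ?_⟩
        obtain ⟨g, hg⟩ := hno U t
        exact hg (ht ⟨g, trivial⟩)
      exact LinearMap.congr_fun this _
    obtain ⟨U, t, ht⟩ := hfix
    induction t using Tens.ind with
    | h x u =>
    have hg (g : G) : ∃ h : H, g • x = op h • x := by
      obtain ⟨h, hh, -⟩ := Tens.exact (ht g)
      exact ⟨h, hh⟩
    have hr (y : X) : ∃ h : H, y = op h • x := by
      refine htr {y | ∃ h : H, y = op h • x} ?_ ?_ ⟨x, 1, by simp⟩ y
      · rintro g _ ⟨h, rfl⟩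
        obtain ⟨k, hk⟩ := hg g
        exact ⟨k * h, by rw [smul_comm, hk, smul_smul, op_mul]⟩
      · rintro k _ ⟨h, rfl⟩
        exact ⟨h * k.unop, by rw [smul_smul, op_mul, op_unop]⟩
    -- Otherwise $X$ factors through restriction to a proper subgroup of $H$, which kills $e^H_H$.
    -- Bifreeness at $1$ is automatic, so the orbit biset needs no stabilizer estimate.
    have hQ : rightRange x = ⊤ := by
      by_contra hQ
      refine h ?_
      rw [actLin_eq_orbitBiset x K hX (fun _ => ⟨Nat.coprime_one_right _, Nat.coprime_one_right _⟩)
        hr, LinearMap.comp_apply, resClass_topIdem K 1 hQ, map_zero, map_zero]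
    have hl (h : H) : ∃ g : G, g • x = op h • x := by
      rw [← mem_rightRange, hQ]; trivial
    refine dominates_of_rightStab_eq_bot hX hg hl ?_
    rw [mark_act_topIdem K hX hl hr] at h
    by_contra hne
    refine h ?_
    rw [hB _ (rightStab_normal hl) hne (card_rightStab (H := H) x ▸ (hX x).2), Rat.cast_zero]

end Dominates

/-! ### Subfunctors of the Burnside functor -/

section Subfunctors

variable {p : ℕ} [Fact p.Prime] {K : Type v} [Field K]

theorem eDelta_le_sum {A : Set FiniteGrp.{u}} {H : FiniteGrp.{u}} (hH : H ∈ A) :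
    eDelta p K H ≤ SubmoduleFunctor.sum fun H : A => eDelta p K H.1 :=
  fun Y => le_iSup (fun H : A => (eDelta p K H.1).obj Y) ⟨H, hH⟩

section

variable (F : SubmoduleFunctor (burnsideFunctor.{u, v} p K)) {G H : FiniteGrp.{u}}

/-- The evaluation of a subfunctor of `KB`, as a submodule of `KB(G)`. -/
def SubmoduleFunctor.eval (G : FiniteGrp.{u}) : Submodule K (RBurnside G K) := F.obj ⟨G⟩

theorem actLin_mem (a : BifreeClass H G p) {x : RBurnside G K} (hx : x ∈ F.eval G) :
    actLin K a x ∈ F.eval H :=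
  F.map_mem (X := ⟨G⟩) (Y := ⟨H⟩) (1 ⊗ₜ cl a) x hx

variable [CharZero K]

/-- The product $e^G_G\,x$ is a non-zero multiple of $e^G_G$, and it stays in $F(G)$ because it is
built from inductions of restrictions of $x$. -/
theorem topIdem_mem_of_mark_ne_zero {x : RBurnside G K} (hx : x ∈ F.eval G)
    (h : mark K ⊤ x ≠ 0) : topIdem K G ∈ F.eval G := by
  rw [← Submodule.smul_mem_iff _ h, ← topIdem_mul, topIdem_mul_eq K p]
  exact Submodule.sum_mem _ fun X _ => Submodule.smul_mem _ _
    (actLin_mem F (G := FiniteGrp.of X) _ (actLin_mem F (H := FiniteGrp.of X) _ hx))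

variable {F}

theorem eDelta_le_iff : eDelta p K G ≤ F ↔ topIdem K G ∈ F.eval G := by
  constructor
  · intro h
    refine h ⟨G⟩ (Submodule.subset_span ⟨𝟙 _, ?_⟩)
    exact (LinearMap.congr_fun (congrArg ModuleCat.Hom.hom ((burnsideFunctor p K).map_id ⟨G⟩))
      _).trans (burnsideIdempotent_top K)
  · intro h Y
    refine Submodule.span_le.2 ?_
    rintro _ ⟨f, rfl⟩
    refine F.map_mem f _ ?_
    rw [burnsideIdempotent_top]
    exact h

variable (p K) in
theorem topIdem_mem_eDelta (G : FiniteGrp.{u}) : topIdem K G ∈ (eDelta p K G).eval G :=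
  eDelta_le_iff.1 le_rfl

/-- A subfunctor of `KB` is determined by the idempotents `e^G_G` it contains. -/
theorem le_of_eDelta_le {F' : SubmoduleFunctor (burnsideFunctor.{u, v} p K)}
    (h : ∀ G : FiniteGrp.{u}, eDelta p K G ≤ F → eDelta p K G ≤ F') : F ≤ F' := by
  have key (n : ℕ) (G : FiniteGrp.{u}) (hn : Nat.card G = n) (x : RBurnside G K)
      (hx : x ∈ F.eval G) : x ∈ F'.eval G := by
    induction n using Nat.strong_induction_on generalizing G with
    | h n ih =>
    -- The first term is a multiple of $e^G_G$, non-zero only if $e^G_G\in F(G)$; the rest is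
    -- induced from proper subgroups, where induction on the order applies.
    rw [eq_topIdem_mul_add K p x]
    refine Submodule.sub_mem _ ?_ (Submodule.sum_mem _ fun X hX => Submodule.smul_mem _ _ ?_)
    · rw [topIdem_mul]
      by_cases hm : mark K ⊤ x = 0
      · rw [hm, zero_smul]; exact Submodule.zero_mem _
      · exact Submodule.smul_mem _ _
          (eDelta_le_iff.1 (h G (eDelta_le_iff.2 (topIdem_mem_of_mark_ne_zero F hx hm))))
    · refine actLin_mem F' (G := FiniteGrp.of X) _ (ih _ ?_ (FiniteGrp.of X) rfl _
        (actLin_mem F (H := FiniteGrp.of X) _ hx))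
      rw [← hn]
      exact card_lt_card_group (by simpa using hX)
  exact fun G x hx => key _ G.grp rfl x hx

end

variable [CharZero K]

variable (K) in
-- The inflation of $e^H_H$ to $G$ has mark $1$ at $G$, because $G$ maps onto $H$; its biset is
-- bifree because the kernel is a $p'$-group.
theorem eDelta_le_of_dominates {G H : FiniteGrp.{u}} (h : Dominates p G H) :
    eDelta p K G ≤ eDelta p K H := by
  obtain ⟨N, hN, hp, ⟨e⟩⟩ := h
  rw [eDelta_le_iff]
  let f : G →* H := e.toMonoidHom.comp (QuotientGroup.mk' N)
  have hf : Function.Surjective f := e.surjective.comp (QuotientGroup.mk'_surjective N)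
  have hker : f.ker = N := by
    ext g
    exact e.map_eq_one_iff.trans (QuotientGroup.eq_one_iff g)
  have hb := pullBiset_isBifree (f := f) (p := p) (hker ▸ hp)
  refine topIdem_mem_of_mark_ne_zero _ (actLin_mem _ ((pullBiset f).cls hb)
    (topIdem_mem_eDelta p K H)) ?_
  rw [mark_pullBiset, Subgroup.map_top_of_surjective f hf, mark_top_topIdem]
  exact one_ne_zero

variable (K) in
theorem eDelta_eq_of_mulEquiv {G H : FiniteGrp.{u}} (e : G ≃* H) :
    eDelta p K G = eDelta p K H := by
  have key {G H : FiniteGrp.{u}} (e : G ≃* H) : Dominates p G H :=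
    ⟨⊥, inferInstance, by simp, ⟨QuotientGroup.quotientBot.trans e⟩⟩
  exact le_antisymm (eDelta_le_of_dominates K (key e)) (eDelta_le_of_dominates K (key e.symm))

variable (p K) in
-- If $G$ is not a $B^\Delta_p$-group, some $m_{G,N}\ne0$ with $N\ne1$. Deflation then gives
-- $\mathbf e^\Delta_{G/N}\subseteq\mathbf e^\Delta_G$, inflation gives the reverse, and $G/N$ is
-- smaller.
theorem exists_isBDeltaGroup_eDelta_eq (G : FiniteGrp.{u}) :
    ∃ H : FiniteGrp.{u}, IsBDeltaGroup p H ∧ eDelta p K G = eDelta p K H := by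
  induction hn : Nat.card G using Nat.strong_induction_on generalizing G with
  | h n ih =>
  by_cases hG : IsBDeltaGroup p G
  · exact ⟨G, hG, rfl⟩
  · simp only [IsBDeltaGroup, not_forall] at hG
    obtain ⟨N, hN, hne, hp, hm⟩ := hG
    obtain ⟨H, hH, hH'⟩ := ih (Nat.card (G ⧸ N)) (by
      rw [← hn, Subgroup.card_eq_card_quotient_mul_card_subgroup N]
      exact lt_mul_of_one_lt_right Nat.card_pos ((Subgroup.one_lt_card_iff_ne_bot N).2 hne))
      (FiniteGrp.of (G ⧸ N)) rfl
    refine ⟨H, hH, Eq.trans (le_antisymm ?_ ?_) hH'⟩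
    · exact eDelta_le_of_dominates K ⟨N, hN, hp, ⟨MulEquiv.refl _⟩⟩
    · have hb := pushBiset_isBifree (f := QuotientGroup.mk' N) (p := p)
        ((QuotientGroup.ker_mk' N).symm ▸ hp)
      rw [eDelta_le_iff]
      refine topIdem_mem_of_mark_ne_zero _ (G := FiniteGrp.of (G ⧸ N))
        (actLin_mem _ ((pushBiset (QuotientGroup.mk' N)).cls hb) (topIdem_mem_eDelta p K G)) ?_
      refine (mark_deflation_topIdem K N hb).trans_ne ?_
      exact Rat.cast_ne_zero.2 hm

/-- If `e^G_G` lies in a sum of subfunctors `e^Δ_H` for `B^Δ_p`-groups `H`, then `G` dominates one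
of these groups `H`. -/
theorem exists_dominates_of_eDelta_le_sum {A : Set FiniteGrp.{u}}
    (hA : ∀ H ∈ A, IsBDeltaGroup p H) {G : FiniteGrp.{u}}
    (h : eDelta p K G ≤ SubmoduleFunctor.sum fun H : A => eDelta p K H.1) :
    ∃ H ∈ A, Dominates p G H := by
  by_contra! hno
  have hmem : topIdem K G ∈ LinearMap.ker (mark K (⊤ : Subgroup G)) := by
    -- If $G$ dominates no member of $A$, every biset sends every $e^H_H$ into the kernel of the
    -- mark at $G$. That kernel is a submodule, so it contains the sum, but not $e^G_G$.
    have hle : (⨆ H : A, (eDelta p K H.1).eval G) ≤ LinearMap.ker (mark K (⊤ : Subgroup G)) := by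
      refine iSup_le fun H => Submodule.span_le.2 ?_
      rintro _ ⟨f, rfl⟩
      change mark K ⊤ (scalarLift₂ K (actHom (H := G) (G := H.1) (p := p)) f
        (burnsideIdempotent K ⊤)) = 0
      rw [burnsideIdempotent_top]
      induction f using scalar_ind with
      | hadd x y hx hy => rw [map_add, LinearMap.add_apply, map_add, hx, hy, add_zero]
      | h r a =>
        induction a using BifreeClass.ind with | h X hX =>
        have h1 : r ⊗ₜ[ℤ] cl (X.cls hX) = r • ((1 : K) ⊗ₜ[ℤ] cl (X.cls hX)) := by
          simp [TensorProduct.smul_tmul']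
        rw [h1, map_smul, LinearMap.smul_apply, map_smul]
        by_contra hr
        refine hno H.1 H.2 (dominates_of_mark_ne_zero K (hA H.1 H.2) X hX fun h0 => hr ?_)
        rw [actLin] at h0
        rw [h0, smul_zero]
    exact hle (eDelta_le_iff.1 h)
  rw [LinearMap.mem_ker, mark_top_topIdem] at hmem
  exact one_ne_zero hmem

variable {S : Set FiniteGrp.{u}}

/-- The closed subset of `S` attached to a subfunctor. -/
def closedSubsetOf (S : Set FiniteGrp.{u}) (F : SubmoduleFunctor (burnsideFunctor.{u, v} p K)) :
    ClosedSubset p S :=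
  ⟨{H | H ∈ S ∧ eDelta p K H ≤ F}, fun _ h => h.1, fun _ hH _ hG hd =>
    ⟨hG, (eDelta_le_of_dominates K hd).trans hH.2⟩⟩

/-- A subfunctor is determined by the $\mathbf e^\Delta_G$ it contains, and each of these equals
$\mathbf e^\Delta_H$ for some $H\in S$. -/
theorem closedSubsetOf_le_iff (hS : IsBDeltaRepresentatives p S)
    {F F' : SubmoduleFunctor (burnsideFunctor.{u, v} p K)} :
    closedSubsetOf S F ≤ closedSubsetOf S F' ↔ F ≤ F' := by
  constructor
  · intro h
    refine le_of_eDelta_le fun G hG => ?_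
    obtain ⟨H, hH, hGH⟩ := exists_isBDeltaGroup_eDelta_eq p K G
    obtain ⟨H', ⟨hH', ⟨e⟩⟩, -⟩ := hS.2 H hH
    rw [hGH, eDelta_eq_of_mulEquiv K e] at hG ⊢
    exact (h ⟨hH', hG⟩).2
  · exact fun h H hH => ⟨hH.1, hH.2.trans h⟩

theorem closedSubsetOf_sum (hS : IsBDeltaRepresentatives p S) (A : ClosedSubset p S) :
    closedSubsetOf S (SubmoduleFunctor.sum fun H : (A : Set FiniteGrp.{u}) => eDelta p K H.1) =
      A := by
  refine Subtype.ext (Set.ext fun G => ⟨fun hG => ?_, fun hG => ⟨A.2.1 hG, eDelta_le_sum hG⟩⟩)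
  obtain ⟨H, hH, hd⟩ := exists_dominates_of_eDelta_le_sum (fun H hH => hS.1 H (A.2.1 hH)) hG.2
  exact A.2.2 H hH G hG.1 hd

end Subfunctors

end PBifree

end

theorem mainTheorem2 (p : ℕ) [Fact p.Prime] (K : Type v) [Field K] [CharZero K]
    (S : Set FiniteGrp.{u}) (hS : PBifree.IsBDeltaRepresentatives p S) :
    ∃ Θ : PBifree.SubmoduleFunctor (PBifree.burnsideFunctor.{u, v} p K) ≃o
        PBifree.ClosedSubset p S,
      (∀ F, (Θ F : Set FiniteGrp.{u}) = {H | H ∈ S ∧ PBifree.eDelta p K H ≤ F}) ∧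
      ∀ A : PBifree.ClosedSubset p S,
        Θ.symm A = PBifree.SubmoduleFunctor.sum
          (fun H : (A : Set FiniteGrp.{u}) => PBifree.eDelta p K H) := by
  have hinj : Function.Injective (PBifree.closedSubsetOf (p := p) (K := K) S) := fun F F' h =>
    le_antisymm ((PBifree.closedSubsetOf_le_iff hS).1 h.le)
      ((PBifree.closedSubsetOf_le_iff hS).1 h.ge)
  let Θ : PBifree.SubmoduleFunctor (PBifree.burnsideFunctor.{u, v} p K) ≃o
      PBifree.ClosedSubset p S :=
    { toFun := PBifree.closedSubsetOf S
      invFun := fun A => PBifree.SubmoduleFunctor.sum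
        fun H : (A : Set FiniteGrp.{u}) => PBifree.eDelta p K H
      -- An injective map with a right inverse is a bijection with that inverse.
      left_inv := fun F => hinj (PBifree.closedSubsetOf_sum hS _)
      right_inv := PBifree.closedSubsetOf_sum hS
      map_rel_iff' := PBifree.closedSubsetOf_le_iff hS }
  exact ⟨Θ, fun _ => rfl, fun _ => rfl⟩
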